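/- Let $k$ be a field, $\Gamma$ an abelian group, and $X$ a finite-dimensional (left–left) Yetter–Drinfeld module over $k\Gamma$ with a basis $F_1,\dots,F_\theta$ such that $\delta(F_i)=g_i\otimes F_i$ with $g_i\in\Gamma$ and $\gamma\triangleright F_i=\chi_i(\gamma)F_i$ for $\gamma\in\Gamma$, with characters $\chi_i:\Gamma\to k^\times$. Let $\Psi(x\otimes y)=x_{(-1)}\triangleright y\otimes x_{(0)}$ be the braiding of $X$, so that $\Psi(F_i\otimes F_j)=q_{ij}F_j\otimes F_i$ with $q_{ij}=\chi_j(g_i)$, and assume $q_{ij}=q_{ji}$ for all $i,j$. Let $\bar F_1,\dots,\bar F_\theta$ be the dual basis of $X^*$, and let $X^*$ carry the braiding $\Psi^*$ dual to $\Psi$ with respect to the pairing $\langle\alpha\otimes\beta,x\otimes y\rangle=\langle\beta,x\rangle\langle\alpha,y\rangle$. For a braided vector space $(V,\Psi)$ let $\mathcal B(V)=\bigoplus_n V^{\otimes n}/\ker\mathfrak S_n$ be its Nichols algebra, where $\mathfrak S_n$ is the total braided symmetrizer. Let $\mathfrak U$ be the algebra generated by $F_i$, $\bar F_i$ $(1\le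 i\le\theta)$ and $\Gamma$, subject to the relations of the group $\Gamma$, the relations of $\mathcal B(X)$ among the $F_i$, the relations of $\mathcal B(X^*)$ among the $\bar F_i$, the relations $\gamma F_j\gamma^{-1}=\chi_j(\gamma)F_j$ and $\gamma\bar F_j\gamma^{-1}=\chi_j(\gamma)^{-1}\bar F_j$ for $\gamma\in\Gamma$ (in particular $g_iF_jg_i^{-1}=q_{ij}F_j$ and $g_i\bar F_jg_i^{-1}=q_{ij}^{-1}\bar F_j$), and $$\bar F_iF_j-q_{ji}F_j\bar F_i=\delta_{ij}(1-g_j^2).$$ Then: 1. The canonical algebra maps $\mathcal B(X)\to\mathfrak U$ and $\mathcal B(X^*)\to\mathfrak U$ (with $F_i\mapsto F_i$, $\bar F_i\mapsto\bar F_i$) are injective, and multiplication $\mathcal B(X^*)\otimes\mathcal B(X)\otimes k\Gamma\to\mathfrak U$ is an isomorphism of vector spaces. 2. If the $g_i$ generate $\Gamma$, then $\mathfrak U$ is the algebra generated by $\mathcal B(X)$, $\mathcal B(X^*)$ and $\Gamma$ with only the relations $g_iF_jg_i^{-1}=q_{ij}F_j$, $\bar F_iF_j-q_{ji}F_j\bar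 F_i=\delta_{ij}(1-g_j^2)$ and $g_i\bar F_jg_i^{-1}=q_{ij}^{-1}\bar F_j$ for $1\le i,j\le\theta$. 3. The algebra $\mathfrak U$ has a Hopf algebra structure in which all elements of $\Gamma$ are group-like (with $S(\gamma)=\gamma^{-1}$), and $$\Delta(F_j)=g_j\otimes F_j+F_j\otimes 1,\qquad \Delta(\bar F_j)=g_j\otimes\bar F_j+\bar F_j\otimes 1,$$ $$\varepsilon(F_j)=\varepsilon(\bar F_j)=0,\qquad S(F_i)=-g_i^{-1}F_i,\qquad S(\bar F_i)=-g_i^{-1}\bar F_i.$$ -/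

import Mathlib

open scoped TensorProduct

noncomputable section

universe u v w

/-! ## Braided vector spaces and Nichols algebras -/

section Nichols

variable {k : Type u} [Field k] {V : Type w} [AddCommGroup V] [Module k V]

/-- Concatenation `V ⊗ T(V) → T(V)`. -/
def concat (k : Type u) [Field k] (V : Type w) [AddCommGroup V] [Module k V] :
    V ⊗[k] TensorAlgebra k V →ₗ[k] TensorAlgebra k V :=
  TensorProduct.lift ((LinearMap.mul k (TensorAlgebra k V)) ∘ₗ TensorAlgebra.ι k)

/-- `v ⊗ w ⊗ t ↦ Ψ(v ⊗ w) ⊗ t`, followed by concatenation of the second factor with `t`. -/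
def braidPast (Ψ : V ⊗[k] V →ₗ[k] V ⊗[k] V) :
    V ⊗[k] (V ⊗[k] TensorAlgebra k V) →ₗ[k] V ⊗[k] TensorAlgebra k V :=
  (concat k V).lTensor V ∘ₗ (TensorProduct.assoc k V V (TensorAlgebra k V)).toLinearMap ∘ₗ
    Ψ.rTensor (TensorAlgebra k V) ∘ₗ
      (TensorProduct.assoc k V V (TensorAlgebra k V)).symm.toLinearMap

/-- The operator `(t, s) ↦ (v t, v ⊗ t + braidPast Ψ (v ⊗ s))` on `T(V) × (V ⊗ T(V))`, whose
iteration computes `toFront`. -/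
def toFrontStep (Ψ : V ⊗[k] V →ₗ[k] V ⊗[k] V) :
    V →ₗ[k] Module.End k (TensorAlgebra k V × (V ⊗[k] TensorAlgebra k V)) :=
  LinearMap.mk₂ k
    (fun x p => (TensorAlgebra.ι k x * p.1, x ⊗ₜ[k] p.1 + braidPast Ψ (x ⊗ₜ[k] p.2)))
    (fun x y p => by
      simp only [map_add, add_mul, TensorProduct.add_tmul, Prod.mk_add_mk]
      congr 1; abel)
    (fun c x p => by
      simp only [map_smul, smul_mul_assoc, ← TensorProduct.smul_tmul', smul_add, Prod.smul_mk])
    (fun x p r => by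
      simp only [Prod.fst_add, Prod.snd_add, mul_add, TensorProduct.tmul_add, map_add,
        Prod.mk_add_mk]
      congr 1; abel)
    (fun c x p => by
      simp only [Prod.smul_fst, Prod.smul_snd, mul_smul_comm, TensorProduct.tmul_smul, map_smul,
        smul_add, Prod.smul_mk])

/-- The map `id + Ψ₁ + Ψ₁Ψ₂ + ⋯ + Ψ₁Ψ₂⋯Ψₙ₋₁ : V^{⊗ n} → V ⊗ V^{⊗ (n-1)}` (and `0` for `n = 0`),
where `Ψᵢ` is the braiding of the tensor factors `i` and `i + 1`.
It is characterized by the two lemmas that follow. -/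
def toFront (Ψ : V ⊗[k] V →ₗ[k] V ⊗[k] V) :
    TensorAlgebra k V →ₗ[k] V ⊗[k] TensorAlgebra k V :=
  LinearMap.snd k _ _ ∘ₗ LinearMap.applyₗ (1, 0) ∘ₗ
    (TensorAlgebra.lift k (toFrontStep Ψ)).toLinearMap

lemma toFront_one (Ψ : V ⊗[k] V →ₗ[k] V ⊗[k] V) : toFront Ψ 1 = 0 := by
  simp [toFront]

lemma toFront_ι_mul (Ψ : V ⊗[k] V →ₗ[k] V ⊗[k] V) (x : V) (t : TensorAlgebra k V) :
    toFront Ψ (TensorAlgebra.ι k x * t) = x ⊗ₜ[k] t + braidPast Ψ (x ⊗ₜ[k] toFront Ψ t) := by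
  have key : ∀ t : TensorAlgebra k V,
      (TensorAlgebra.lift k (toFrontStep Ψ) t (1, 0)).1 = t := by
    intro t
    have h : ∀ p : TensorAlgebra k V × (V ⊗[k] TensorAlgebra k V),
        (TensorAlgebra.lift k (toFrontStep Ψ) t p).1 = t * p.1 := by
      induction t using TensorAlgebra.induction with
      | algebraMap r => intro p; simp [Algebra.smul_def, Module.algebraMap_end_apply]
      | ι x => intro p; simp [toFrontStep]
      | mul a b ha hb => intro p; simp [ha, hb, mul_assoc]
      | add a b ha hb => intro p; simp [ha, hb, add_mul]
    simpa using h (1, 0)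
  have h1 := key t
  simp only [toFront, LinearMap.comp_apply, AlgHom.toLinearMap_apply, map_mul,
    TensorAlgebra.lift_ι_apply, LinearMap.applyₗ_apply_apply, Module.End.mul_apply,
    LinearMap.snd_apply]
  change x ⊗ₜ[k] (TensorAlgebra.lift k (toFrontStep Ψ) t (1, 0)).1 + _ = _
  rw [h1]

/-- The total braided symmetrizer `𝔖ₙ` of `V^{⊗ n}`, i.e. the sum over the permutations `σ` of the
lifts of `σ` to the braid group, defined through the factorization
`𝔖ₙ = (id ⊗ 𝔖ₙ₋₁) (id + Ψ₁ + Ψ₁Ψ₂ + ⋯ + Ψ₁Ψ₂⋯Ψₙ₋₁)`. It is meaningful on the component of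
degree `n` of the tensor algebra. -/
def symmetrizer (Ψ : V ⊗[k] V →ₗ[k] V ⊗[k] V) :
    ℕ → (TensorAlgebra k V →ₗ[k] TensorAlgebra k V)
  | 0 => LinearMap.id
  | n + 1 => concat k V ∘ₗ (symmetrizer Ψ n).lTensor V ∘ₗ toFront Ψ

/-- The relations of the Nichols algebra: every element of degree `n` of the tensor algebra that
lies in the kernel of the total braided symmetrizer `𝔖ₙ` is zero. -/
inductive NicholsRel (Ψ : V ⊗[k] V →ₗ[k] V ⊗[k] V) :
    TensorAlgebra k V → TensorAlgebra k V → Prop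
  | ker (n : ℕ) (x : TensorAlgebra k V)
      (hx : x ∈ (LinearMap.range (TensorAlgebra.ι k : V →ₗ[k] TensorAlgebra k V)) ^ n)
      (h : symmetrizer Ψ n x = 0) : NicholsRel Ψ x 0

/-- The Nichols algebra `𝔅(V)` of the braided vector space `(V, Ψ)`. -/
def NicholsAlgebra (Ψ : V ⊗[k] V →ₗ[k] V ⊗[k] V) : Type (max u w) :=
  RingQuot (NicholsRel Ψ)

instance (Ψ : V ⊗[k] V →ₗ[k] V ⊗[k] V) : Ring (NicholsAlgebra Ψ) :=
  inferInstanceAs (Ring (RingQuot (NicholsRel Ψ)))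

instance (Ψ : V ⊗[k] V →ₗ[k] V ⊗[k] V) : Algebra k (NicholsAlgebra Ψ) :=
  inferInstanceAs (Algebra k (RingQuot (NicholsRel Ψ)))

/-- The projection `T(V) → 𝔅(V)`. -/
def NicholsAlgebra.mk (Ψ : V ⊗[k] V →ₗ[k] V ⊗[k] V) : TensorAlgebra k V →ₐ[k] NicholsAlgebra Ψ :=
  RingQuot.mkAlgHom k (NicholsRel Ψ)

/-- The inclusion of the generators `V → 𝔅(V)`. -/
def NicholsAlgebra.ι (Ψ : V ⊗[k] V →ₗ[k] V ⊗[k] V) : V →ₗ[k] NicholsAlgebra Ψ :=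
  (NicholsAlgebra.mk Ψ).toLinearMap ∘ₗ TensorAlgebra.ι k

/-- The algebra map `𝔅(V) → A` induced by an algebra map `T(V) → A` that respects the relations. -/
def NicholsAlgebra.lift (Ψ : V ⊗[k] V →ₗ[k] V ⊗[k] V) {A : Type*} [Ring A] [Algebra k A]
    (f : TensorAlgebra k V →ₐ[k] A) (h : ∀ x y, NicholsRel Ψ x y → f x = f y) :
    NicholsAlgebra Ψ →ₐ[k] A :=
  RingQuot.liftAlgHom k ⟨f, fun {x y} => h x y⟩

/-- The nested pairing `⟨α ⊗ β, x ⊗ y⟩ = ⟨β, x⟩ ⟨α, y⟩`, as an isomorphism `V* ⊗ V* ≃ (V ⊗ V)*`. -/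
def nestedPairing (k : Type u) [Field k] (V : Type w) [AddCommGroup V] [Module k V]
    [FiniteDimensional k V] :
    Module.Dual k V ⊗[k] Module.Dual k V ≃ₗ[k] Module.Dual k (V ⊗[k] V) :=
  (TensorProduct.comm k (Module.Dual k V) (Module.Dual k V)).trans
    (TensorProduct.dualDistribEquiv k V V)

/-- The braiding `Ψ*` of the dual space, determined by
`⟨Ψ*(α ⊗ β), x ⊗ y⟩ = ⟨α ⊗ β, Ψ(x ⊗ y)⟩` for the nested pairing. -/
def dualBraiding [FiniteDimensional k V] (Ψ : V ⊗[k] V →ₗ[k] V ⊗[k] V) :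
    Module.Dual k V ⊗[k] Module.Dual k V →ₗ[k] Module.Dual k V ⊗[k] Module.Dual k V :=
  (nestedPairing k V).symm.toLinearMap ∘ₗ Ψ.dualMap ∘ₗ (nestedPairing k V).toLinearMap

end Nichols

/-! ## Yetter–Drinfeld modules over a group algebra -/

/-- A left–left Yetter–Drinfeld structure over the Hopf algebra `kΓ` on the vector space `X`. -/
structure YetterDrinfeld (k : Type u) (Γ : Type v) (X : Type w) [Field k] [Group Γ]
    [AddCommGroup X] [Module k X] where
  /-- the left action of `Γ`, i.e. of `kΓ` -/
  act : Representation k Γ X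
  /-- the left coaction of `kΓ` -/
  coact : X →ₗ[k] MonoidAlgebra k Γ ⊗[k] X
  coassoc :
    (TensorProduct.assoc k (MonoidAlgebra k Γ) (MonoidAlgebra k Γ) X).toLinearMap ∘ₗ
        (Coalgebra.comul (R := k) (A := MonoidAlgebra k Γ)).rTensor X ∘ₗ coact =
      coact.lTensor (MonoidAlgebra k Γ) ∘ₗ coact
  counit_coact :
    (Coalgebra.counit (R := k) (A := MonoidAlgebra k Γ)).rTensor X ∘ₗ coact =
      TensorProduct.mk k k X 1
  /-- the Yetter–Drinfeld axiom `δ(g ▷ x) = g x₍₋₁₎ g⁻¹ ⊗ g ▷ x₍₀₎` -/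
  compat : ∀ (g : Γ) (x : X),
    coact (act g x) =
      TensorProduct.map
        (LinearMap.mulLeft k (MonoidAlgebra.of k Γ g) ∘ₗ
          LinearMap.mulRight k (MonoidAlgebra.of k Γ g⁻¹))
        (act g) (coact x)

/-- The Yetter–Drinfeld braiding `Ψ(x ⊗ y) = x₍₋₁₎ ▷ y ⊗ x₍₀₎` of `X` with itself. -/
def YetterDrinfeld.braiding {k : Type u} {Γ : Type v} {X : Type w} [Field k] [Group Γ]
    [AddCommGroup X] [Module k X] (D : YetterDrinfeld k Γ X) : X ⊗[k] X →ₗ[k] X ⊗[k] X :=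
  (TensorProduct.lift D.act.asAlgebraHom.toLinearMap).rTensor X ∘ₗ
    (TensorProduct.assoc k (MonoidAlgebra k Γ) X X).symm.toLinearMap ∘ₗ
      (TensorProduct.comm k X X).toLinearMap.lTensor (MonoidAlgebra k Γ) ∘ₗ
        (TensorProduct.assoc k (MonoidAlgebra k Γ) X X).toLinearMap ∘ₗ
          D.coact.rTensor X

/-! ## The double bosonization -/

/-- The coproduct, counit and antipode of the Hopf algebra `A` take the stated values on the
elements `G γ` (`γ ∈ Γ`), `F j` and `Fbar j` of `A`. -/
structure HasRadfordHopfStructure (k : Type u) {A : Type w} [Field k] [Ring A] [HopfAlgebra k A]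
    {Γ : Type v} [Group Γ] {θ : ℕ} (G : Γ →* A) (g : Fin θ → Γ) (F Fbar : Fin θ → A) : Prop where
  comul_G : ∀ γ, Coalgebra.comul (R := k) (G γ) = G γ ⊗ₜ[k] G γ
  comul_F : ∀ j, Coalgebra.comul (R := k) (F j) = G (g j) ⊗ₜ[k] F j + F j ⊗ₜ[k] (1 : A)
  comul_Fbar : ∀ j,
    Coalgebra.comul (R := k) (Fbar j) = G (g j) ⊗ₜ[k] Fbar j + Fbar j ⊗ₜ[k] (1 : A)
  counit_G : ∀ γ, Coalgebra.counit (R := k) (G γ) = 1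
  counit_F : ∀ j, Coalgebra.counit (R := k) (F j) = 0
  counit_Fbar : ∀ j, Coalgebra.counit (R := k) (Fbar j) = 0
  antipode_G : ∀ γ, HopfAlgebra.antipode k (G γ) = G γ⁻¹
  antipode_F : ∀ i, HopfAlgebra.antipode k (F i) = -(G (g i)⁻¹ * F i)
  antipode_Fbar : ∀ i, HopfAlgebra.antipode k (Fbar i) = -(G (g i)⁻¹ * Fbar i)


section DoubleBosonization

variable {k : Type u} {Γ : Type v} {X : Type w} [Field k] [CommGroup Γ]
  [AddCommGroup X] [Module k X] [FiniteDimensional k X] {θ : ℕ}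

/-- The generators of the double bosonization: `F₁, …, F_θ`, `F̄₁, …, F̄_θ` and the elements
of `Γ`. -/
inductive DBGen (θ : ℕ) (Γ : Type v) : Type v
  | F (i : Fin θ) : DBGen θ Γ
  | Fbar (i : Fin θ) : DBGen θ Γ
  | G (γ : Γ) : DBGen θ Γ

/-- The algebra map from `T(X)` to the free algebra on the generators that sends the basis vector
`F i` to the generator `Fᵢ`. -/
def freeOfTensor (F : Module.Basis (Fin θ) k X) :
    TensorAlgebra k X →ₐ[k] FreeAlgebra k (DBGen θ Γ) :=
  TensorAlgebra.lift k (F.constr k fun i => FreeAlgebra.ι k (DBGen.F i))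

/-- The algebra map from `T(X*)` to the free algebra on the generators that sends the dual basis
vector of `F i` to the generator `F̄ᵢ`. -/
def freeOfTensorDual (F : Module.Basis (Fin θ) k X) :
    TensorAlgebra k (Module.Dual k X) →ₐ[k] FreeAlgebra k (DBGen θ Γ) :=
  TensorAlgebra.lift k (F.dualBasis.constr k fun i => FreeAlgebra.ι k (DBGen.Fbar i))

/-- The relations of the double bosonization: those of the group `Γ`, those of `𝔅(X)` and of
`𝔅(X*)`, `g Fⱼ = χⱼ(g) Fⱼ g` and `g F̄ⱼ = χⱼ(g)⁻¹ F̄ⱼ g` for `g ∈ Γ`, and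
`F̄ᵢ Fⱼ - q_{j,i} Fⱼ F̄ᵢ = δ_{i,j} (1 - gⱼ²)`. -/
inductive DBRel (D : YetterDrinfeld k Γ X) (F : Module.Basis (Fin θ) k X) (g : Fin θ → Γ)
    (χ : Fin θ → Γ →* kˣ) (q : Fin θ → Fin θ → k) :
    FreeAlgebra k (DBGen θ Γ) → FreeAlgebra k (DBGen θ Γ) → Prop
  | one : DBRel D F g χ q (FreeAlgebra.ι k (DBGen.G 1)) 1
  | mul (a b : Γ) : DBRel D F g χ q (FreeAlgebra.ι k (DBGen.G (a * b)))
      (FreeAlgebra.ι k (DBGen.G a) * FreeAlgebra.ι k (DBGen.G b))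
  | nichols (x y : TensorAlgebra k X) (h : NicholsRel D.braiding x y) :
      DBRel D F g χ q (freeOfTensor F x) (freeOfTensor F y)
  | nicholsDual (x y : TensorAlgebra k (Module.Dual k X))
      (h : NicholsRel (dualBraiding D.braiding) x y) :
      DBRel D F g χ q (freeOfTensorDual F x) (freeOfTensorDual F y)
  | conj (a : Γ) (j : Fin θ) : DBRel D F g χ q
      (FreeAlgebra.ι k (DBGen.G a) * FreeAlgebra.ι k (DBGen.F j))
      ((χ j a : k) • (FreeAlgebra.ι k (DBGen.F j) * FreeAlgebra.ι k (DBGen.G a)))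
  | conjDual (a : Γ) (j : Fin θ) : DBRel D F g χ q
      (FreeAlgebra.ι k (DBGen.G a) * FreeAlgebra.ι k (DBGen.Fbar j))
      ((χ j a : k)⁻¹ • (FreeAlgebra.ι k (DBGen.Fbar j) * FreeAlgebra.ι k (DBGen.G a)))
  | cross (i j : Fin θ) : DBRel D F g χ q
      (FreeAlgebra.ι k (DBGen.Fbar i) * FreeAlgebra.ι k (DBGen.F j) -
        q j i • (FreeAlgebra.ι k (DBGen.F j) * FreeAlgebra.ι k (DBGen.Fbar i)))
      (if i = j then 1 - FreeAlgebra.ι k (DBGen.G (g j)) ^ 2 else 0)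

/-- The double bosonization `𝔘`. -/
def DoubleBosonization (D : YetterDrinfeld k Γ X) (F : Module.Basis (Fin θ) k X) (g : Fin θ → Γ)
    (χ : Fin θ → Γ →* kˣ) (q : Fin θ → Fin θ → k) : Type (max u v) :=
  RingQuot (DBRel D F g χ q)

namespace DoubleBosonization

variable (D : YetterDrinfeld k Γ X) (F : Module.Basis (Fin θ) k X) (g : Fin θ → Γ)
  (χ : Fin θ → Γ →* kˣ) (q : Fin θ → Fin θ → k)

instance : Ring (DoubleBosonization D F g χ q) :=
  inferInstanceAs (Ring (RingQuot (DBRel D F g χ q)))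

instance : Algebra k (DoubleBosonization D F g χ q) :=
  inferInstanceAs (Algebra k (RingQuot (DBRel D F g χ q)))

/-- The projection from the free algebra. -/
def mk : FreeAlgebra k (DBGen θ Γ) →ₐ[k] DoubleBosonization D F g χ q :=
  RingQuot.mkAlgHom k (DBRel D F g χ q)

lemma mk_rel {x y : FreeAlgebra k (DBGen θ Γ)} (h : DBRel D F g χ q x y) :
    mk D F g χ q x = mk D F g χ q y :=
  RingQuot.mkAlgHom_rel k h

/-- The element `Fᵢ` of `𝔘`. -/
def gen (i : Fin θ) : DoubleBosonization D F g χ q :=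
  mk D F g χ q (FreeAlgebra.ι k (DBGen.F i))

/-- The element `F̄ᵢ` of `𝔘`. -/
def genBar (i : Fin θ) : DoubleBosonization D F g χ q :=
  mk D F g χ q (FreeAlgebra.ι k (DBGen.Fbar i))

/-- The canonical map `Γ → 𝔘`. -/
def grp : Γ →* DoubleBosonization D F g χ q where
  toFun γ := mk D F g χ q (FreeAlgebra.ι k (DBGen.G γ))
  map_one' := (mk_rel D F g χ q .one).trans (map_one _)
  map_mul' a b := (mk_rel D F g χ q (.mul a b)).trans (map_mul _ _ _)

/-- The canonical algebra map `𝔅(X) → 𝔘`. -/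
def ofNichols : NicholsAlgebra D.braiding →ₐ[k] DoubleBosonization D F g χ q :=
  NicholsAlgebra.lift D.braiding ((mk D F g χ q).comp (freeOfTensor F)) fun x y h =>
    mk_rel D F g χ q (.nichols x y h)

/-- The canonical algebra map `𝔅(X*) → 𝔘`. -/
def ofNicholsDual :
    NicholsAlgebra (dualBraiding D.braiding) →ₐ[k] DoubleBosonization D F g χ q :=
  NicholsAlgebra.lift (dualBraiding D.braiding) ((mk D F g χ q).comp (freeOfTensorDual F))
    fun x y h => mk_rel D F g χ q (.nicholsDual x y h)

/-- The multiplication map `𝔅(X*) ⊗ 𝔅(X) ⊗ kΓ → 𝔘`. -/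
def mulMap :
    (NicholsAlgebra (dualBraiding D.braiding) ⊗[k] NicholsAlgebra D.braiding) ⊗[k]
        MonoidAlgebra k Γ →ₗ[k] DoubleBosonization D F g χ q :=
  LinearMap.mul' k _ ∘ₗ
    TensorProduct.map
      (LinearMap.mul' k _ ∘ₗ
        TensorProduct.map (ofNicholsDual D F g χ q).toLinearMap (ofNichols D F g χ q).toLinearMap)
      (MonoidAlgebra.lift k (DoubleBosonization D F g χ q) Γ (grp D F g χ q)).toLinearMap

end DoubleBosonization

end DoubleBosonization

end

noncomputable section

/-! ## Skew derivations of the tensor algebra -/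

section TensorAlgebraDerivations

set_option linter.unusedSectionVars false

variable {k V I : Type*} [Field k] [AddCommGroup V] [Module k V]

/-! The Nichols relations are controlled by skew derivations. For a diagonal braiding with matrix
`p` the map `toFront` has components `∂ᵢ`, with `∂ᵢ(eⱼ t) = δᵢⱼ t + pⱼᵢ eⱼ ∂ᵢ(t)`, and `𝔖ₙ₊₁ = ∑ eᵢ
𝔖ₙ ∂ᵢ`. So `x` of degree `n + 1` lies in `ker 𝔖ₙ₊₁` iff every `∂ᵢ x` lies in `ker 𝔖ₙ`
(`isAdapted_diagBraiding`). If `p` is symmetric, the derivations for `p` and for `p⁻¹` commute up to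
scalars, so the same kernels are also described by `p⁻¹` (`IsAdapted.inv`). This double description
is where the symmetry of `q` is used most.

The derivations descend to the Nichols algebra and detect zero: an element with vanishing counit and
vanishing derivatives is `0` (`eq_zero_of_deriv_eq_zero`). Hence a map from `T(V)` to `𝔅 ⊗ Y` that
intertwines derivations kills the relations, by induction on the degree, once its counit part does
(`map_nicholsKer_eq_zero_of_deriv`). The coproduct and the antipode are checked on the Nichols
relations in this way; all other Hopf identities reduce to generators.

For the triangular decomposition, the cross relation moves every `F̄ᵢ` to the left, so
multiplication is onto. For injectivity, a module `W` over `𝔅(X) # kΓ` is induced to `𝔅(X*) ⊗ W`,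
with `Fⱼ` acting by the formula that the cross relation forces. The point is that the relations of
`𝔅(X)` hold there (`inducedTensor_nicholsKer`): moving `F̄ᵢ` past `t` in `T(X)` produces only a
rescaling of `t`, its `q`-derivative and its `q⁻¹`-derivative (`mul_tensorHom_eq`), and all three
preserve the kernels. For `W = 𝔅(X) ⊗ kΓ`, acting on `1 ⊗ 1 ⊗ 1` inverts the multiplication map.

If the `gᵢ` generate `Γ`, the elements of `Γ` satisfying a given commutation rule form a subgroup,
so the rules for the `gᵢ` imply those for all of `Γ`. -/

theorem Module.Basis.vector_induction (e : Module.Basis I k V) {P : V → Prop} (zero : P 0)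
    (single : ∀ i, P (e i)) (add : ∀ x y, P x → P y → P (x + y))
    (smul : ∀ (c : k) x, P x → P (c • x)) (v : V) : P v := by
  have hv : v ∈ Submodule.span k (Set.range e) := by rw [e.span_eq]; trivial
  induction hv using Submodule.span_induction with
  | zero => exact zero
  | mem _ h => obtain ⟨i, rfl⟩ := h; exact single i
  | add x y _ _ hx hy => exact add x y hx hy
  | smul c x _ hx => exact smul c x hx

/-- Induction on the tensor algebra by left multiplication with basis vectors. -/
theorem TensorAlgebra.basis_induction (e : Module.Basis I k V) {P : TensorAlgebra k V → Prop}
    (one : P 1) (add : ∀ s t, P s → P t → P (s + t)) (smul : ∀ (c : k) t, P t → P (c • t))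
    (mul : ∀ j t, P t → P (TensorAlgebra.ι k (e j) * t)) (t : TensorAlgebra k V) : P t := by
  have key : ∀ a t : TensorAlgebra k V, P t → P (a * t) := by
    intro a
    induction a using TensorAlgebra.induction with
    | algebraMap r => intro t ht; rw [← Algebra.smul_def]; exact smul r t ht
    | ι x =>
      intro t ht
      induction x using e.vector_induction with
      | zero => simpa using smul 0 t ht
      | single => exact mul _ t ht
      | add x y hx hy => rw [map_add, add_mul]; exact add _ _ hx hy
      | smul c x hx => rw [map_smul, smul_mul_assoc]; exact smul _ _ hx
    | mul a b ha hb => intro t ht; rw [mul_assoc]; exact ha _ (hb _ ht)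
    | add a b ha hb => intro t ht; rw [add_mul]; exact add _ _ (ha _ ht) (hb _ ht)
  simpa using key t 1 one

/-- The degree `n` component of the tensor algebra. -/
abbrev tensorPower (k V : Type*) [Field k] [AddCommGroup V] [Module k V] (n : ℕ) :
    Submodule k (TensorAlgebra k V) :=
  (LinearMap.range (TensorAlgebra.ι k : V →ₗ[k] TensorAlgebra k V)) ^ n

theorem ι_mul_mem_tensorPower (v : V) {n : ℕ} {t : TensorAlgebra k V}
    (ht : t ∈ tensorPower k V n) : TensorAlgebra.ι k v * t ∈ tensorPower k V (n + 1) := by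
  rw [tensorPower, pow_succ']
  exact Submodule.mul_mem_mul ⟨v, rfl⟩ ht

theorem tensorPower_succ_le (e : Module.Basis I k V) {n : ℕ} {C : Submodule k (TensorAlgebra k V)}
    (h : ∀ j, ∀ t ∈ tensorPower k V n, TensorAlgebra.ι k (e j) * t ∈ C) :
    tensorPower k V (n + 1) ≤ C := by
  rw [tensorPower, pow_succ', Submodule.mul_le]
  rintro _ ⟨v, rfl⟩ t ht
  induction v using e.vector_induction with
  | zero => simp
  | single => exact h _ t ht
  | add x y hx hy => rw [map_add, add_mul]; exact C.add_mem hx hy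
  | smul c x hx => rw [map_smul, smul_mul_assoc]; exact C.smul_mem _ hx

theorem mem_tensorPower_zero {t : TensorAlgebra k V} :
    t ∈ tensorPower k V 0 ↔ ∃ c : k, c • (1 : TensorAlgebra k V) = t := by
  rw [tensorPower, pow_zero, Submodule.one_eq_span, Submodule.mem_span_singleton]

/-! ### Diagonal braidings, their skew derivations, and rescalings -/

variable [DecidableEq I]

/-- The diagonal braiding `e i ⊗ e j ↦ p i j • e j ⊗ e i`. -/
def diagBraiding (e : Module.Basis I k V) (p : I → I → k) : V ⊗[k] V →ₗ[k] V ⊗[k] V :=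
  (e.tensorProduct e).constr k fun ij => p ij.1 ij.2 • (e ij.2 ⊗ₜ[k] e ij.1)

theorem diagBraiding_tmul (e : Module.Basis I k V) (p : I → I → k) (i j : I) :
    diagBraiding e p (e i ⊗ₜ e j) = p i j • (e j ⊗ₜ[k] e i) := by
  have := (e.tensorProduct e).constr_basis k (fun ij => p ij.1 ij.2 • (e ij.2 ⊗ₜ[k] e ij.1)) (i, j)
  rwa [Module.Basis.tensorProduct_apply] at this

theorem eq_diagBraiding (e : Module.Basis I k V) {p : I → I → k} {Ψ : V ⊗[k] V →ₗ[k] V ⊗[k] V}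
    (h : ∀ i j, Ψ (e i ⊗ₜ e j) = p i j • (e j ⊗ₜ[k] e i)) : Ψ = diagBraiding e p := by
  refine (e.tensorProduct e).ext fun ij => ?_
  rw [Module.Basis.tensorProduct_apply', h, diagBraiding_tmul]

/-- The coefficient of `e i` in the first tensor factor. -/
def leftCoord (e : Module.Basis I k V) (i : I) : V ⊗[k] TensorAlgebra k V →ₗ[k] TensorAlgebra k V :=
  (TensorProduct.lid k _).toLinearMap ∘ₗ (e.coord i).rTensor _

theorem leftCoord_tmul (e : Module.Basis I k V) (i j : I) (t : TensorAlgebra k V) :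
    leftCoord e i (e j ⊗ₜ t) = if i = j then t else 0 := by
  simp [leftCoord, Finsupp.single_apply, eq_comm]

theorem sum_tmul_leftCoord [Fintype I] (e : Module.Basis I k V)
    (z : V ⊗[k] TensorAlgebra k V) : ∑ i, e i ⊗ₜ leftCoord e i z = z := by
  induction z using TensorProduct.induction_on with
  | zero => simp
  | add x y hx hy => simp only [map_add, TensorProduct.tmul_add, Finset.sum_add_distrib, hx, hy]
  | tmul v t =>
    induction v using e.vector_induction with
    | zero => simp
    | single j => simp [leftCoord_tmul, TensorProduct.tmul_ite]
    | add x y hx hy =>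
      simp only [TensorProduct.add_tmul, map_add, TensorProduct.tmul_add, Finset.sum_add_distrib,
        hx, hy]
    | smul c x hx =>
      simp only [← TensorProduct.smul_tmul', map_smul, TensorProduct.tmul_smul, ← Finset.smul_sum,
        hx]

/-- Braiding `e j` past a leading `e m` costs `p j m` and leaves `e m` in front, so only `m = i`
contributes. This is the second term of the skew Leibniz rule. -/
theorem leftCoord_braidPast (e : Module.Basis I k V) (p : I → I → k) (i j : I)
    (z : V ⊗[k] TensorAlgebra k V) :
    leftCoord e i (braidPast (diagBraiding e p) (e j ⊗ₜ z)) =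
      p j i • (TensorAlgebra.ι k (e j) * leftCoord e i z) := by
  induction z using TensorProduct.induction_on with
  | zero => simp
  | add x y hx hy => simp only [TensorProduct.tmul_add, map_add, hx, hy, mul_add, smul_add]
  | tmul v t =>
    induction v using e.vector_induction with
    | zero => simp
    | single m =>
      have : braidPast (diagBraiding e p) (e j ⊗ₜ (e m ⊗ₜ t)) =
          p j m • (e m ⊗ₜ (TensorAlgebra.ι k (e j) * t)) := by
        simp [braidPast, diagBraiding_tmul, concat, TensorProduct.smul_tmul']
      rw [this, map_smul, leftCoord_tmul, leftCoord_tmul]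
      split_ifs with h
      · rw [h]
      · simp
    | add x y hx hy =>
      simp only [TensorProduct.add_tmul, TensorProduct.tmul_add, map_add, hx, hy, mul_add, smul_add]
    | smul c x hx =>
      simp only [← TensorProduct.smul_tmul', TensorProduct.tmul_smul, map_smul, hx, mul_smul_comm]
      rw [smul_comm]

/-- The skew derivation `∂ᵢ` of the tensor algebra with `∂ᵢ(eⱼ t) = δᵢⱼ t + pⱼᵢ eⱼ ∂ᵢ(t)`. -/
def leftDeriv (e : Module.Basis I k V) (p : I → I → k) (i : I) :
    TensorAlgebra k V →ₗ[k] TensorAlgebra k V :=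
  leftCoord e i ∘ₗ toFront (diagBraiding e p)

variable (e : Module.Basis I k V) (p : I → I → k)

theorem leftDeriv_one (i : I) : leftDeriv e p i 1 = 0 := by
  simp [leftDeriv, toFront_one]

theorem leftDeriv_ι_mul (i j : I) (t : TensorAlgebra k V) :
    leftDeriv e p i (TensorAlgebra.ι k (e j) * t) =
      (if i = j then t else 0) + p j i • (TensorAlgebra.ι k (e j) * leftDeriv e p i t) := by
  simp only [leftDeriv, LinearMap.comp_apply, toFront_ι_mul, map_add, leftCoord_tmul,
    leftCoord_braidPast]

theorem leftDeriv_mem_zero (i : I) {t : TensorAlgebra k V} (ht : t ∈ tensorPower k V 0) :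
    leftDeriv e p i t = 0 := by
  obtain ⟨c, rfl⟩ := mem_tensorPower_zero.1 ht
  rw [map_smul, leftDeriv_one, smul_zero]

theorem leftDeriv_mem (i : I) {n : ℕ} : ∀ {t : TensorAlgebra k V}, t ∈ tensorPower k V (n + 1) →
    leftDeriv e p i t ∈ tensorPower k V n := by
  suffices tensorPower k V (n + 1) ≤ (tensorPower k V n).comap (leftDeriv e p i) from
    fun {t} ht => this ht
  induction n with
  | zero =>
    refine tensorPower_succ_le e fun j t ht => ?_
    rw [Submodule.mem_comap, leftDeriv_ι_mul, leftDeriv_mem_zero e p i ht, mul_zero, smul_zero,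
      add_zero]
    split_ifs
    exacts [ht, zero_mem _]
  | succ n ih =>
    refine tensorPower_succ_le e fun j t ht => ?_
    rw [Submodule.mem_comap, leftDeriv_ι_mul]
    refine add_mem ?_ (Submodule.smul_mem _ _ (ι_mul_mem_tensorPower _ (ih ht)))
    split_ifs
    exacts [ht, zero_mem _]

/-- On words, the `p⁻¹`-derivation is the derivation from the right, up to a scalar depending on the
multidegree; left and right derivations commute. The direct check compares the two recursions in
`t`: the terms with `i = m` agree outright, those with `j = m` because `p` is symmetric. -/
theorem leftDeriv_leftDeriv_inv (hp : ∀ i j, p i j = p j i) (h0 : ∀ i j, p i j ≠ 0) (i j : I)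
    (t : TensorAlgebra k V) :
    p i j • leftDeriv e p i (leftDeriv e p⁻¹ j t) = leftDeriv e p⁻¹ j (leftDeriv e p i t) := by
  induction t using TensorAlgebra.basis_induction e with
  | one => simp [leftDeriv_one]
  | add s t hs ht => simp only [map_add, smul_add, hs, ht]
  | smul c t ht => rw [map_smul, map_smul, smul_comm, ht, map_smul, map_smul]
  | mul m t ht =>
    have h1 : p i j * ((p m j)⁻¹ * p m i) = p m i * ((p m j)⁻¹ * p i j) := by ring
    simp only [leftDeriv_ι_mul, map_add, map_smul, Pi.inv_apply, smul_add, ← ht, mul_smul_comm]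
    rw [apply_ite (leftDeriv e p i), apply_ite (leftDeriv e p⁻¹ j), map_zero, map_zero]
    simp only [smul_smul, ← add_assoc, h1]
    congr 1
    by_cases hi : i = m <;> by_cases hj : j = m
    · subst hi; subst hj; simp [h0, add_comm]
    · subst hi; simp [hj, h0]
    · subst hj; rw [hp i j]; simp [hi]
    · simp [hi, hj]

/-- The algebra endomorphism of the tensor algebra with `e j ↦ c j • e j`. -/
def tensorScale (c : I → k) : TensorAlgebra k V →ₐ[k] TensorAlgebra k V :=
  TensorAlgebra.lift k (e.constr k fun j => c j • TensorAlgebra.ι k (e j))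

theorem tensorScale_ι (c : I → k) (j : I) :
    tensorScale e c (TensorAlgebra.ι k (e j)) = c j • TensorAlgebra.ι k (e j) := by
  simp [tensorScale]

theorem leftDeriv_tensorScale (c : I → k) (i : I) (t : TensorAlgebra k V) :
    leftDeriv e p i (tensorScale e c t) = c i • tensorScale e c (leftDeriv e p i t) := by
  induction t using TensorAlgebra.basis_induction e with
  | one => simp [leftDeriv_one]
  | add s t hs ht => simp only [map_add, smul_add, hs, ht]
  | smul a t ht => simp only [map_smul, ht, smul_comm a]
  | mul m t ht =>
    simp only [map_mul, tensorScale_ι, smul_mul_assoc, map_smul, leftDeriv_ι_mul, ht, map_add,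
      smul_add, mul_smul_comm, smul_smul]
    congr 1
    · by_cases h : i = m
      · simp [h]
      · simp [h]
    · congr 1; ring

theorem tensorScale_mem (c : I → k) {n : ℕ} : ∀ {t : TensorAlgebra k V},
    t ∈ tensorPower k V n → tensorScale e c t ∈ tensorPower k V n := by
  suffices tensorPower k V n ≤ (tensorPower k V n).comap (tensorScale e c).toLinearMap from
    fun {t} ht => this ht
  induction n with
  | zero =>
    intro t ht
    obtain ⟨a, rfl⟩ := mem_tensorPower_zero.1 ht
    exact mem_tensorPower_zero.2 ⟨a, by simp⟩
  | succ n ih =>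
    refine tensorPower_succ_le e fun j t ht => ?_
    simp only [Submodule.mem_comap, AlgHom.toLinearMap_apply, map_mul, tensorScale_ι,
      smul_mul_assoc]
    exact Submodule.smul_mem _ _ (ι_mul_mem_tensorPower _ (ih ht))

/-! ### The kernels of the symmetrizers -/

/-- The kernel of the symmetrizer in degree `n`. -/
def nicholsKer (Ψ : V ⊗[k] V →ₗ[k] V ⊗[k] V) (n : ℕ) : Submodule k (TensorAlgebra k V) :=
  tensorPower k V n ⊓ LinearMap.ker (symmetrizer Ψ n)

variable {e p} {Ψ : V ⊗[k] V →ₗ[k] V ⊗[k] V}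

theorem nicholsKer_zero : nicholsKer Ψ 0 = ⊥ := by
  rw [nicholsKer, symmetrizer, LinearMap.ker_id, inf_bot_eq]

/-- The kernels of the symmetrizers are determined recursively by the derivations `∂ᵢ`. -/
def IsAdapted (Ψ : V ⊗[k] V →ₗ[k] V ⊗[k] V) (e : Module.Basis I k V) (p : I → I → k) : Prop :=
  ∀ n x, x ∈ nicholsKer Ψ (n + 1) ↔
    x ∈ tensorPower k V (n + 1) ∧ ∀ i, leftDeriv e p i x ∈ nicholsKer Ψ n

/-- For the zero braiding `toFront` just splits off the first letter, so it inverts concatenation.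
-/
theorem toFront_zero_ι_mul (v : V) (t : TensorAlgebra k V) :
    toFront 0 (TensorAlgebra.ι k v * t) = v ⊗ₜ[k] t := by
  rw [toFront_ι_mul]
  simp [braidPast]

theorem sum_ι_mul_eq_zero_iff [Fintype I] (y : I → TensorAlgebra k V) :
    ∑ i, TensorAlgebra.ι k (e i) * y i = 0 ↔ ∀ i, y i = 0 := by
  refine ⟨fun h i => ?_, fun h => by simp [h]⟩
  have := congrArg (leftCoord e i ∘ₗ toFront 0) h
  simpa [toFront_zero_ι_mul, leftCoord_tmul] using this

/-- Expanding `toFront` in the basis gives `𝔖ₙ₊₁ x = ∑ eᵢ 𝔖ₙ(∂ᵢ x)`, and words with different first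
letters are independent. -/
theorem isAdapted_diagBraiding [Fintype I] (e : Module.Basis I k V) (p : I → I → k) :
    IsAdapted (diagBraiding e p) e p := by
  intro n x
  have h : symmetrizer (diagBraiding e p) (n + 1) x =
      ∑ i, TensorAlgebra.ι k (e i) * symmetrizer (diagBraiding e p) n (leftDeriv e p i x) := by
    rw [symmetrizer, LinearMap.comp_apply, LinearMap.comp_apply,
      ← sum_tmul_leftCoord e (toFront (diagBraiding e p) x)]
    simp [concat, leftDeriv]
  simp only [nicholsKer, Submodule.mem_inf, LinearMap.mem_ker, h, sum_ι_mul_eq_zero_iff]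
  exact ⟨fun ⟨h1, h2⟩ => ⟨h1, fun i => ⟨leftDeriv_mem e p i h1, h2 i⟩⟩,
    fun ⟨h1, h2⟩ => ⟨h1, fun i => (h2 i).2⟩⟩

/-- In degree one `∂ᵢ` is the `i`-th coordinate, whatever the matrix `p` is. -/
theorem eq_zero_of_mem_one_of_leftDeriv_eq_zero [Fintype I] {x : TensorAlgebra k V}
    (hx : x ∈ tensorPower k V 1) (h : ∀ i, leftDeriv e p i x = 0) : x = 0 := by
  rw [tensorPower, pow_one] at hx
  obtain ⟨v, rfl⟩ := hx
  have : v = 0 := by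
    refine e.ext_elem fun i => ?_
    have h2 : leftDeriv e p i (TensorAlgebra.ι k v) =
        algebraMap k (TensorAlgebra k V) (e.repr v i) := by
      have := toFront_ι_mul (diagBraiding e p) v 1
      rw [mul_one, toFront_one, TensorProduct.tmul_zero, map_zero, add_zero] at this
      simp [leftDeriv, this, leftCoord, Algebra.smul_def]
    rw [h i, eq_comm, TensorAlgebra.algebraMap_eq_zero_iff] at h2
    simpa using h2
  rw [this, map_zero]

namespace IsAdapted

theorem leftDeriv_mem (hA : IsAdapted Ψ e p) (i : I) {n : ℕ} {x : TensorAlgebra k V}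
    (hx : x ∈ nicholsKer Ψ (n + 1)) : leftDeriv e p i x ∈ nicholsKer Ψ n :=
  ((hA n x).1 hx).2 i

/-- Induction on the degree. In degree one both conditions force `x = 0`. Above that, membership is
tested by one derivation of each kind, and these may be exchanged since they commute up to a nonzero
scalar. -/
theorem inv [Fintype I] (hA : IsAdapted Ψ e p) (hp : ∀ i j, p i j = p j i)
    (h0 : ∀ i j, p i j ≠ 0) : IsAdapted Ψ e p⁻¹ := by
  intro n
  have hcomm (i j : I) (x : TensorAlgebra k V) {m : ℕ} :
      leftDeriv e p i (leftDeriv e p⁻¹ j x) ∈ nicholsKer Ψ m ↔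
        leftDeriv e p⁻¹ j (leftDeriv e p i x) ∈ nicholsKer Ψ m := by
    rw [← leftDeriv_leftDeriv_inv e p hp h0, Submodule.smul_mem_iff _ (h0 i j)]
  induction n with
  | zero =>
    intro x
    rw [hA 0 x]
    refine and_congr_right fun hx => ?_
    simp only [nicholsKer_zero, Submodule.mem_bot]
    constructor
    · intro h i
      rw [eq_zero_of_mem_one_of_leftDeriv_eq_zero hx h, map_zero]
    · intro h i
      rw [eq_zero_of_mem_one_of_leftDeriv_eq_zero hx h, map_zero]
  | succ n ih =>
    intro x
    rw [hA (n + 1) x]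
    refine and_congr_right fun hx => ?_
    constructor
    · intro h i
      rw [hA n]
      exact ⟨_root_.leftDeriv_mem e _ i hx, fun j => (hcomm j i x).2 (((ih _).1 (h j)).2 i)⟩
    · intro h i
      rw [ih]
      exact ⟨_root_.leftDeriv_mem e _ i hx, fun j => (hcomm i j x).1 (hA.leftDeriv_mem i (h j))⟩

theorem tensorScale_mem (hA : IsAdapted Ψ e p) (c : I → k) {n : ℕ} {x : TensorAlgebra k V}
    (hx : x ∈ nicholsKer Ψ n) : tensorScale e c x ∈ nicholsKer Ψ n := by
  induction n generalizing x with
  | zero =>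
    rw [nicholsKer_zero, Submodule.mem_bot] at *
    rw [hx, map_zero]
  | succ n ih =>
    rw [hA n] at *
    refine ⟨_root_.tensorScale_mem e c hx.1, fun i => ?_⟩
    rw [leftDeriv_tensorScale]
    exact Submodule.smul_mem _ _ (ih (hx.2 i))

end IsAdapted

end TensorAlgebraDerivations

end

noncomputable section

/-! ## Skew derivations of Nichols algebras -/

namespace NicholsAlgebra

set_option linter.unusedSectionVars false

variable {k V I : Type*} [Field k] [AddCommGroup V] [Module k V] {Ψ : V ⊗[k] V →ₗ[k] V ⊗[k] V}

theorem mk_surjective : Function.Surjective (mk Ψ) :=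
  RingQuot.mkAlgHom_surjective k _

theorem mk_ι (v : V) : mk Ψ (TensorAlgebra.ι k v) = ι Ψ v := rfl

theorem mk_eq_zero {n : ℕ} {x : TensorAlgebra k V} (hx : x ∈ nicholsKer Ψ n) : mk Ψ x = 0 :=
  (RingQuot.mkAlgHom_rel k (NicholsRel.ker n x hx.1 hx.2)).trans (map_zero _)

theorem rel_eq_of_nicholsKer {A : Type*} [Ring A] [Algebra k A] {f : TensorAlgebra k V →ₐ[k] A}
    (h : ∀ n, ∀ x ∈ nicholsKer Ψ n, f x = 0) (x y : TensorAlgebra k V) (hxy : NicholsRel Ψ x y) :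
    f x = f y := by
  obtain ⟨n, x, hx, hk⟩ := hxy
  rw [h n x ⟨hx, hk⟩, map_zero]

theorem lift_mk {A : Type*} [Ring A] [Algebra k A] (f : TensorAlgebra k V →ₐ[k] A)
    (h : ∀ x y, NicholsRel Ψ x y → f x = f y) (t : TensorAlgebra k V) :
    lift Ψ f h (mk Ψ t) = f t :=
  RingQuot.liftAlgHom_mkAlgHom_apply _ _ _ _

theorem lift_ι {A : Type*} [Ring A] [Algebra k A] (f : TensorAlgebra k V →ₐ[k] A)
    (h : ∀ x y, NicholsRel Ψ x y → f x = f y) (v : V) :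
    lift Ψ f h (ι Ψ v) = f (TensorAlgebra.ι k v) :=
  lift_mk f h _

theorem basis_induction (e : Module.Basis I k V) {P : NicholsAlgebra Ψ → Prop}
    (one : P 1) (add : ∀ s t, P s → P t → P (s + t)) (smul : ∀ (c : k) t, P t → P (c • t))
    (mul : ∀ j t, P t → P (ι Ψ (e j) * t)) (t : NicholsAlgebra Ψ) : P t := by
  obtain ⟨t, rfl⟩ := mk_surjective t
  induction t using TensorAlgebra.basis_induction e with
  | one => rwa [map_one]
  | add s t hs ht => rw [map_add]; exact add _ _ hs ht
  | smul c t ht => rw [map_smul]; exact smul _ _ ht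
  | mul j t ht => rw [map_mul]; exact mul _ _ ht

theorem hom_ext (e : Module.Basis I k V) {A : Type*} [Semiring A] [Algebra k A]
    {f f' : NicholsAlgebra Ψ →ₐ[k] A} (h : ∀ j, f (ι Ψ (e j)) = f' (ι Ψ (e j))) : f = f' := by
  ext t
  induction t using basis_induction e with
  | one => simp
  | add s t hs ht => rw [map_add, map_add, hs, ht]
  | smul c t ht => rw [map_smul, map_smul, ht]
  | mul j t ht => rw [map_mul, map_mul, h, ht]

/-- The kernel is trivial in degree `0`, and in positive degree every element is a combination of
products starting with a basis vector. -/
theorem map_nicholsKer_eq_zero (e : Module.Basis I k V) {N : Type*} [AddCommGroup N] [Module k N]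
    {f : TensorAlgebra k V →ₗ[k] N} (h : ∀ j t, f (TensorAlgebra.ι k (e j) * t) = 0) {n : ℕ}
    {x : TensorAlgebra k V} (hx : x ∈ nicholsKer Ψ n) : f x = 0 := by
  cases n with
  | zero =>
    rw [nicholsKer_zero, Submodule.mem_bot] at hx
    rw [hx, map_zero]
  | succ n =>
    have : tensorPower k V (n + 1) ≤ LinearMap.ker f :=
      tensorPower_succ_le e fun j t _ => h j t
    exact this hx.1

variable {e : Module.Basis I k V} {p : I → I → k} [DecidableEq I]

/-- The counit of the Nichols algebra. -/
def counit (e : Module.Basis I k V) : NicholsAlgebra Ψ →ₐ[k] k :=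
  lift Ψ TensorAlgebra.algebraMapInv <| rel_eq_of_nicholsKer fun _ _ hx =>
    map_nicholsKer_eq_zero (f := TensorAlgebra.algebraMapInv.toLinearMap) e
      (fun j t => by simp [TensorAlgebra.algebraMapInv]) hx

theorem counit_ι (v : V) : counit e (ι Ψ v) = 0 := by
  simp [counit, lift_ι, TensorAlgebra.algebraMapInv]

/-- The algebra endomorphism of the Nichols algebra with `e j ↦ c j • e j`. -/
def scale (hA : ∃ p, IsAdapted Ψ e p) (c : I → k) : NicholsAlgebra Ψ →ₐ[k] NicholsAlgebra Ψ :=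
  lift Ψ ((mk Ψ).comp (tensorScale e c)) <| rel_eq_of_nicholsKer fun _ _ hx =>
    mk_eq_zero (hA.choose_spec.tensorScale_mem c hx)

theorem scale_mk (hA : ∃ p, IsAdapted Ψ e p) (c : I → k) (t : TensorAlgebra k V) :
    scale hA c (mk Ψ t) = mk Ψ (tensorScale e c t) := lift_mk _ _ _

theorem scale_ι (hA : ∃ p, IsAdapted Ψ e p) (c : I → k) (j : I) :
    scale hA c (ι Ψ (e j)) = c j • ι Ψ (e j) := by
  rw [← mk_ι, scale_mk, tensorScale_ι, map_smul]

theorem scale_scale (hA : ∃ p, IsAdapted Ψ e p) (c d : I → k) (b : NicholsAlgebra Ψ) :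
    scale hA c (scale hA d b) = scale hA (c * d) b := by
  have : (scale hA c).comp (scale hA d) = scale hA (c * d) := hom_ext e fun j => by
    simp [scale_ι, smul_smul, mul_comm]
  exact congrArg (fun f => f b) this

theorem scale_one (hA : ∃ p, IsAdapted Ψ e p) (b : NicholsAlgebra Ψ) : scale hA 1 b = b := by
  have : scale hA 1 = AlgHom.id k _ := hom_ext e fun j => by simp [scale_ι]
  exact congrArg (fun f => f b) this

/-- The action of `e j` on `𝔅 × 𝔅` that encodes the skew derivation `∂ᵢ`. -/
def derivStep (Ψ : V ⊗[k] V →ₗ[k] V ⊗[k] V) (e : Module.Basis I k V) (p : I → I → k) (i j : I) :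
    Module.End k (NicholsAlgebra Ψ × NicholsAlgebra Ψ) :=
  (LinearMap.mulLeft k (ι Ψ (e j)) ∘ₗ LinearMap.fst k _ _).prod
    ((if i = j then LinearMap.fst k _ _ else 0) +
      p j i • LinearMap.mulLeft k (ι Ψ (e j)) ∘ₗ LinearMap.snd k _ _)

theorem derivStep_apply (i j : I) (z : NicholsAlgebra Ψ × NicholsAlgebra Ψ) :
    derivStep Ψ e p i j z = (ι Ψ (e j) * z.1,
      (if i = j then z.1 else 0) + p j i • (ι Ψ (e j) * z.2)) := by
  rw [derivStep]
  split_ifs <;> simp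

/-- The algebra map `T(V) → End (𝔅 × 𝔅)` that encodes the skew derivation `∂ᵢ`. -/
def derivHom (Ψ : V ⊗[k] V →ₗ[k] V ⊗[k] V) (e : Module.Basis I k V) (p : I → I → k) (i : I) :
    TensorAlgebra k V →ₐ[k] Module.End k (NicholsAlgebra Ψ × NicholsAlgebra Ψ) :=
  TensorAlgebra.lift k (e.constr k fun j => derivStep Ψ e p i j)

/-- A skew derivation is the off-diagonal entry of a triangular representation with `t` and its
rescaling on the diagonal. All three entries preserve the relations, so the algebra map descends to
the Nichols algebra, and `∂ᵢ` with it. -/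
theorem derivHom_apply (i : I) (t : TensorAlgebra k V) (z : NicholsAlgebra Ψ × NicholsAlgebra Ψ) :
    derivHom Ψ e p i t z = (mk Ψ t * z.1, mk Ψ (leftDeriv e p i t) * z.1 +
      mk Ψ (tensorScale e (fun j => p j i) t) * z.2) := by
  induction t using TensorAlgebra.basis_induction e with
  | one => simp [leftDeriv_one]
  | add s t hs ht =>
    simp only [map_add, LinearMap.add_apply, hs, ht, add_mul, Prod.mk_add_mk]
    congr 1; abel
  | smul c t ht => simp only [map_smul, LinearMap.smul_apply, ht, smul_mul_assoc, Prod.smul_mk,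
      smul_add]
  | mul m t ht =>
    have : derivHom Ψ e p i (TensorAlgebra.ι k (e m)) = derivStep Ψ e p i m := by simp [derivHom]
    rw [map_mul, Module.End.mul_apply, ht, this, derivStep_apply]
    simp only [map_mul, mk_ι, mul_assoc, leftDeriv_ι_mul, map_add, map_smul, tensorScale_ι,
      add_mul, smul_mul_assoc, mul_add, smul_add]
    congr 1
    split_ifs <;> simp [add_assoc]

/-- The skew derivation `∂ᵢ` of the Nichols algebra with `∂ᵢ(eⱼ b) = δᵢⱼ b + pⱼᵢ eⱼ ∂ᵢ(b)`. -/
def deriv (hA : IsAdapted Ψ e p) (i : I) : NicholsAlgebra Ψ →ₗ[k] NicholsAlgebra Ψ :=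
  LinearMap.snd k _ _ ∘ₗ LinearMap.applyₗ (1, 0) ∘ₗ
    (lift Ψ (derivHom Ψ e p i) <| rel_eq_of_nicholsKer fun n x hx => by
      refine LinearMap.ext fun z => ?_
      cases n with
      | zero =>
        rw [nicholsKer_zero, Submodule.mem_bot] at hx
        rw [hx, map_zero]
      | succ n =>
        rw [derivHom_apply, mk_eq_zero hx, mk_eq_zero (hA.leftDeriv_mem i hx),
          mk_eq_zero (hA.tensorScale_mem _ hx)]
        simp).toLinearMap

theorem deriv_mk (hA : IsAdapted Ψ e p) (i : I) (t : TensorAlgebra k V) :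
    deriv hA i (mk Ψ t) = mk Ψ (leftDeriv e p i t) := by
  simp [deriv, lift_mk, derivHom_apply]

theorem deriv_one (hA : IsAdapted Ψ e p) (i : I) : deriv hA i 1 = 0 := by
  rw [← map_one (mk Ψ), deriv_mk, leftDeriv_one, map_zero]

theorem deriv_ι_mul (hA : IsAdapted Ψ e p) (i j : I) (b : NicholsAlgebra Ψ) :
    deriv hA i (ι Ψ (e j) * b) = (if i = j then b else 0) + p j i • (ι Ψ (e j) * deriv hA i b) := by
  obtain ⟨t, rfl⟩ := mk_surjective b
  rw [← mk_ι, ← map_mul, deriv_mk, deriv_mk, leftDeriv_ι_mul, map_add, map_smul, map_mul]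
  split_ifs <;> simp

theorem deriv_scale (hA : IsAdapted Ψ e p) (hs : ∃ p, IsAdapted Ψ e p) (c : I → k) (i : I)
    (b : NicholsAlgebra Ψ) :
    deriv hA i (scale hs c b) = c i • scale hs c (deriv hA i b) := by
  obtain ⟨t, rfl⟩ := mk_surjective b
  rw [scale_mk, deriv_mk, deriv_mk, scale_mk, leftDeriv_tensorScale, map_smul]

/-- To reach the last letter, `∂ᵢ` crosses all of `b` and collects `p m i` from each letter `e m`.
-/
theorem deriv_mul_ι (hA : IsAdapted Ψ e p) (i j : I) (b : NicholsAlgebra Ψ) :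
    deriv hA i (b * ι Ψ (e j)) =
      deriv hA i b * ι Ψ (e j) + if i = j then scale ⟨p, hA⟩ (fun m => p m i) b else 0 := by
  induction b using basis_induction e with
  | one =>
    have := deriv_ι_mul hA i j 1
    rw [deriv_one, mul_zero, smul_zero, add_zero, mul_one] at this
    simp [deriv_one, this]
  | add s t hs ht =>
    rw [add_mul, map_add, hs, ht, map_add, map_add]
    split_ifs
    · rw [add_mul]; abel
    · rw [add_mul]; abel
  | smul c t ht =>
    rw [smul_mul_assoc, map_smul, ht, map_smul, map_smul, smul_add, smul_mul_assoc, smul_ite,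
      smul_zero]
  | mul m t ht =>
    rw [mul_assoc, deriv_ι_mul, ht, deriv_ι_mul, map_mul, scale_ι]
    split_ifs <;> simp [mul_add, add_mul, mul_assoc, add_assoc]

/-! ### Detecting zero by derivations -/

/-- The projection of the tensor algebra to its component of degree `n`. -/
def tensorProj (n : ℕ) : TensorAlgebra k V →ₗ[k] TensorAlgebra k V :=
  GradedAlgebra.proj (tensorPower k V) n

theorem tensorProj_mem (n : ℕ) (t : TensorAlgebra k V) : tensorProj n t ∈ tensorPower k V n :=
  SetLike.coe_mem (DirectSum.decompose (tensorPower k V) t n)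

theorem exists_sum_tensorProj (t : TensorAlgebra k V) :
    ∃ s : Finset ℕ, ∑ n ∈ s, tensorProj n t = t := by
  classical
  exact ⟨_, DirectSum.sum_support_decompose (tensorPower k V) t⟩

theorem proj_ι_mul (v : V) (t : TensorAlgebra k V) (n : ℕ) :
    tensorProj (n + 1) (TensorAlgebra.ι k v * t) =
      TensorAlgebra.ι k v * tensorProj n t := by
  rw [add_comm]
  exact DirectSum.coe_decompose_mul_add_of_left_mem (tensorPower k V)
    (by rw [tensorPower, pow_one]; exact ⟨v, rfl⟩)

theorem proj_zero_ι_mul (v : V) (t : TensorAlgebra k V) :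
    tensorProj 0 (TensorAlgebra.ι k v * t) = 0 := by
  refine DirectSum.coe_decompose_mul_of_left_mem_of_not_le (tensorPower k V) (i := 1)
    (by rw [tensorPower, pow_one]; exact ⟨v, rfl⟩) (by simp)

theorem proj_one (n : ℕ) : tensorProj n (1 : TensorAlgebra k V) =
    if n = 0 then 1 else 0 := by
  have h1 : (1 : TensorAlgebra k V) ∈ tensorPower k V 0 :=
    mem_tensorPower_zero.2 ⟨1, one_smul _ _⟩
  split_ifs with h
  · subst h
    exact DirectSum.decompose_of_mem_same (tensorPower k V) h1
  · exact DirectSum.decompose_of_mem_ne (tensorPower k V) h1 (Ne.symm h)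

theorem leftDeriv_proj (i : I) (n : ℕ) (t : TensorAlgebra k V) :
    leftDeriv e p i (tensorProj (n + 1) t) =
      tensorProj n (leftDeriv e p i t) := by
  induction t using TensorAlgebra.basis_induction e generalizing n with
  | one => simp [proj_one, leftDeriv_one]
  | add s t hs ht => rw [map_add, map_add, map_add, hs, ht, map_add]
  | smul c t ht => rw [map_smul, map_smul, map_smul, ht, map_smul]
  | mul j t ht =>
    rw [proj_ι_mul, leftDeriv_ι_mul, leftDeriv_ι_mul, map_add, map_smul]
    congr 1
    · split_ifs <;> simp
    · cases n with
      | zero =>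
        rw [proj_zero_ι_mul, leftDeriv_mem_zero e p i
          (tensorProj_mem 0 t), mul_zero]
      | succ n => rw [ht, proj_ι_mul]

theorem proj_zero_eq (e : Module.Basis I k V) (t : TensorAlgebra k V) :
    tensorProj 0 t =
      algebraMap k _ (counit (Ψ := Ψ) e (mk Ψ t)) := by
  induction t using TensorAlgebra.basis_induction e with
  | one => simp [proj_one]
  | add s t hs ht => rw [map_add, map_add, map_add, map_add, hs, ht]
  | smul c t ht => rw [map_smul, map_smul, map_smul, ht, smul_eq_mul, map_mul, Algebra.smul_def]
  | mul j t ht => rw [proj_zero_ι_mul, map_mul, map_mul, mk_ι, counit_ι, zero_mul, map_zero]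

/-- The quotient is by the ideal generated by the kernels; this shows that the ideal adds nothing in
any degree. The counit handles degree `0`, and `∂ᵢ`, which descends to the quotient, lowers the
degree. -/
theorem proj_mem_nicholsKer (hA : IsAdapted Ψ e p) (n : ℕ) {t : TensorAlgebra k V}
    (ht : mk Ψ t = 0) : tensorProj n t ∈ nicholsKer Ψ n := by
  induction n generalizing t with
  | zero => rw [proj_zero_eq (Ψ := Ψ) e, ht, map_zero, map_zero]; exact zero_mem _
  | succ n ih =>
    rw [hA n]
    refine ⟨tensorProj_mem (n + 1) t, fun i => ?_⟩
    rw [leftDeriv_proj]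
    exact ih (by rw [← deriv_mk hA, ht, map_zero])

/-- Lift to the tensor algebra and split by degree: the derivatives of each positive component lie
in the kernels, hence so does the component. -/
theorem eq_zero_of_deriv_eq_zero (hA : IsAdapted Ψ e p) {b : NicholsAlgebra Ψ}
    (h0 : counit e b = 0) (h : ∀ i, deriv hA i b = 0) : b = 0 := by
  obtain ⟨t, rfl⟩ := mk_surjective b
  obtain ⟨s, hs⟩ := exists_sum_tensorProj t
  rw [← hs, map_sum]
  refine Finset.sum_eq_zero fun n _ => ?_
  cases n with
  | zero => rw [proj_zero_eq (Ψ := Ψ) e, h0, map_zero, map_zero]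
  | succ n =>
    refine mk_eq_zero (n := n + 1) ((hA n _).2
      ⟨tensorProj_mem (n + 1) t, fun i => ?_⟩)
    rw [leftDeriv_proj]
    exact proj_mem_nicholsKer hA n (by rw [← deriv_mk hA, h])

/-! ### Detecting zero in `𝔅 ⊗ Y` -/

variable {Y : Type*} [AddCommGroup Y] [Module k Y]

theorem rid_lTensor_rTensor {M N : Type*} [AddCommGroup M] [Module k M] [AddCommGroup N]
    [Module k N] (f : M →ₗ[k] N) (φ : Y →ₗ[k] k) (z : M ⊗[k] Y) :
    TensorProduct.rid k N (φ.lTensor N (f.rTensor Y z)) =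
      f (TensorProduct.rid k M (φ.lTensor M z)) := by
  induction z using TensorProduct.induction_on with
  | zero => simp
  | tmul x y => simp
  | add x y hx hy => simp only [map_add, hx, hy]

theorem eq_zero_of_rTensor_deriv_eq_zero (hA : IsAdapted Ψ e p) {z : NicholsAlgebra Ψ ⊗[k] Y}
    (h0 : (counit e).toLinearMap.rTensor Y z = 0) (h : ∀ i, (deriv hA i).rTensor Y z = 0) :
    z = 0 := by
  classical
  let b := Module.Basis.ofVectorSpace k Y
  refine (TensorProduct.equivFinsuppOfBasisRight b).map_eq_zero_iff.1 (Finsupp.ext fun m => ?_)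
  rw [TensorProduct.equivFinsuppOfBasisRight_apply, Finsupp.zero_apply]
  refine eq_zero_of_deriv_eq_zero hA ?_ fun i => ?_
  · have := rid_lTensor_rTensor (counit e).toLinearMap (b.coord m) z
    rw [h0, map_zero, map_zero] at this
    exact this.symm
  · rw [← rid_lTensor_rTensor, h, map_zero, map_zero]

/-- A linear map `Φ : T(V) → 𝔅 ⊗ Y` vanishes on the relations of the Nichols algebra if it
intertwines skew derivations and its counit part vanishes there. -/
theorem map_nicholsKer_eq_zero_of_deriv (hA : IsAdapted Ψ e p) {r : I → I → k}
    (hr : IsAdapted Ψ e r) (Φ : TensorAlgebra k V →ₗ[k] NicholsAlgebra Ψ ⊗[k] Y)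
    (X : I → Module.End k (NicholsAlgebra Ψ ⊗[k] Y))
    (h : ∀ i t, (deriv hA i).rTensor Y (Φ t) = X i (Φ (leftDeriv e r i t)))
    (h0 : ∀ n, ∀ x ∈ nicholsKer Ψ n, (counit e).toLinearMap.rTensor Y (Φ x) = 0)
    (n : ℕ) : ∀ x ∈ nicholsKer Ψ n, Φ x = 0 := by
  induction n with
  | zero =>
    intro x hx
    rw [nicholsKer_zero, Submodule.mem_bot] at hx
    rw [hx, map_zero]
  | succ n ih =>
    intro x hx
    refine eq_zero_of_rTensor_deriv_eq_zero hA (h0 _ x hx) fun i => ?_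
    rw [h, ih _ (hr.leftDeriv_mem i hx), map_zero]

/-! ### Coaction, coproduct and antipode -/

section Coaction

variable {A : Type*} [Ring A] [Algebra k A]

/-- The coaction `e j ↦ e j ⊗ G j` on the tensor algebra, with values in `𝔅 ⊗ A`. -/
def coaction (Ψ : V ⊗[k] V →ₗ[k] V ⊗[k] V) (e : Module.Basis I k V) (G : I → A) :
    TensorAlgebra k V →ₐ[k] NicholsAlgebra Ψ ⊗[k] A :=
  TensorAlgebra.lift k (e.constr k fun j => ι Ψ (e j) ⊗ₜ G j)

theorem coaction_ι (G : I → A) (j : I) :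
    coaction Ψ e G (TensorAlgebra.ι k (e j)) = ι Ψ (e j) ⊗ₜ G j := by
  simp [coaction]

/-- The relations are homogeneous for the multigrading recorded by the commuting `G j`. Removing a
letter `e i` removes one factor `G i`, so `∂ᵢ` is intertwined up to left multiplication by `G i`. -/
theorem coaction_nicholsKer (hA : IsAdapted Ψ e p) {G : I → A} (hG : ∀ i j, Commute (G i) (G j))
    (n : ℕ) : ∀ x ∈ nicholsKer Ψ n, coaction Ψ e G x = 0 := by
  refine map_nicholsKer_eq_zero_of_deriv hA hA (coaction Ψ e G).toLinearMap
    (fun i => (LinearMap.mulLeft k (G i)).lTensor _) (fun i t => ?_) (fun n x hx => ?_) n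
  · induction t using TensorAlgebra.basis_induction e with
    | one => simp [leftDeriv_one, Algebra.TensorProduct.one_def, deriv_one]
    | add s t hs ht => simp only [map_add, hs, ht]
    | smul c t ht => simp only [map_smul, ht]
    | mul j t ht =>
      simp only [AlgHom.toLinearMap_apply] at *
      have h1 (z : NicholsAlgebra Ψ ⊗[k] A) : (deriv hA i).rTensor A ((ι Ψ (e j) ⊗ₜ G j) * z) =
          (if i = j then (LinearMap.mulLeft k (G i)).lTensor _ z else 0) +
            p j i • ((ι Ψ (e j) ⊗ₜ G j) * (deriv hA i).rTensor A z) := by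
        induction z using TensorProduct.induction_on with
        | zero => simp
        | add x y hx hy =>
          simp only [mul_add, map_add, hx, hy, smul_add]
          split_ifs <;> abel
        | tmul b a =>
          simp only [Algebra.TensorProduct.tmul_mul_tmul, LinearMap.rTensor_tmul,
            LinearMap.lTensor_tmul, LinearMap.mulLeft_apply, deriv_ι_mul, TensorProduct.add_tmul,
            TensorProduct.smul_tmul']
          split_ifs with h
          · rw [h]
          · simp
      have h2 (z : NicholsAlgebra Ψ ⊗[k] A) : (LinearMap.mulLeft k (G i)).lTensor _
          ((ι Ψ (e j) ⊗ₜ G j) * z) =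
            (ι Ψ (e j) ⊗ₜ G j) * (LinearMap.mulLeft k (G i)).lTensor _ z := by
        induction z using TensorProduct.induction_on with
        | zero => simp
        | add x y hx hy => simp only [mul_add, map_add, hx, hy]
        | tmul b a => simp [← mul_assoc, (hG i j).eq]
      rw [map_mul, coaction_ι, h1, ht, leftDeriv_ι_mul, map_add, map_smul, map_mul, coaction_ι,
        map_add, map_smul, h2]
      split_ifs <;> simp
  · refine map_nicholsKer_eq_zero (f := (counit e).toLinearMap.rTensor A ∘ₗ
      (coaction Ψ e G).toLinearMap) e (fun j t => ?_) hx
    simp only [LinearMap.comp_apply, AlgHom.toLinearMap_apply, map_mul, coaction_ι]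
    induction coaction Ψ e G t using TensorProduct.induction_on with
    | zero => simp
    | add x y hx hy => simp only [mul_add, map_add, hx, hy, add_zero]
    | tmul b a => simp [counit_ι]

/-- The orbit map of an action of the tensor algebra: `e j₁ ⋯ e jₙ ↦ E j₁ (⋯ (E jₙ v))`. -/
def orbit {N : Type*} [AddCommGroup N] [Module k N] (e : Module.Basis I k V)
    (E : I → Module.End k N) (v : N) : TensorAlgebra k V →ₗ[k] N :=
  LinearMap.applyₗ v ∘ₗ (TensorAlgebra.lift k (e.constr k E)).toLinearMap

theorem orbit_one {N : Type*} [AddCommGroup N] [Module k N] (E : I → Module.End k N) (v : N) :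
    orbit e E v 1 = v := by simp [orbit]

theorem orbit_ι_mul {N : Type*} [AddCommGroup N] [Module k N] (E : I → Module.End k N) (v : N)
    (j : I) (t : TensorAlgebra k V) :
    orbit e E v (TensorAlgebra.ι k (e j) * t) = E j (orbit e E v t) := by simp [orbit]

variable {α : NicholsAlgebra Ψ →ₐ[k] A} {G : I → A}

/-- Commutation up to scalars with the generators extends multiplicatively, and the collected
scalars form a rescaling. -/
theorem comm_scale (hs : ∃ p, IsAdapted Ψ e p) {c : I → k} {a : A}
    (h : ∀ j, a * α (ι Ψ (e j)) = c j • (α (ι Ψ (e j)) * a)) (b : NicholsAlgebra Ψ) :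
    a * α b = α (scale hs c b) * a := by
  induction b using basis_induction e with
  | one => simp
  | add s t hs ht => simp only [map_add, mul_add, add_mul, hs, ht]
  | smul c t ht => simp only [map_smul, mul_smul_comm, smul_mul_assoc, ht]
  | mul j t ht =>
    rw [map_mul, ← mul_assoc, h, smul_mul_assoc, mul_assoc, ht, map_mul, scale_ι, map_mul,
      map_smul, smul_mul_assoc, smul_mul_assoc, mul_assoc]

/-- The algebra map `e j ↦ G j ⊗ e j + e j ⊗ 1` respects the relations of the Nichols algebra. -/
theorem coproduct_nicholsKer (hA : IsAdapted Ψ e p) (hG : ∀ i j, Commute (G i) (G j))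
    (h : ∀ i j, G i * α (ι Ψ (e j)) = p i j • (α (ι Ψ (e j)) * G i))
    (f : TensorAlgebra k V →ₐ[k] A ⊗[k] A)
    (hf : ∀ j, f (TensorAlgebra.ι k (e j)) = G j ⊗ₜ α (ι Ψ (e j)) + α (ι Ψ (e j)) ⊗ₜ 1)
    (n : ℕ) : ∀ x ∈ nicholsKer Ψ n, f x = 0 := by
  have hs : ∃ p, IsAdapted Ψ e p := ⟨p, hA⟩
  let Y := A ⊗[k] A
  -- Left multiplication by `G j ⊗ e j + e j ⊗ 1`, transported to `𝔅 ⊗ Y`, where `b ⊗ y` stands for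
  -- `(b ⊗ 1) y`. Moving `G j ⊗ e j` past `b ⊗ 1` rescales `b` by `p j`.
  let E : I → Module.End k (NicholsAlgebra Ψ ⊗[k] Y) := fun j =>
    (LinearMap.mulLeft k (ι Ψ (e j))).rTensor Y +
      TensorProduct.map (scale hs (p j)).toLinearMap
        (LinearMap.mulLeft k (G j ⊗ₜ[k] α (ι Ψ (e j))))
  let Φ := orbit e E (1 ⊗ₜ 1)
  let κ : NicholsAlgebra Ψ ⊗[k] Y →ₗ[k] Y := LinearMap.mul' k Y ∘ₗ
    ((Algebra.TensorProduct.includeLeft (R := k) (S := k) (B := A)).comp α).toLinearMap.rTensor Y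
  -- The counit on `𝔅` leaves only the summands `G j ⊗ e j`, that is, the flipped coaction.
  let ρ : TensorAlgebra k V →ₐ[k] Y :=
    ((Algebra.TensorProduct.comm k A A).toAlgHom.comp
      (Algebra.TensorProduct.map α (AlgHom.id k A))).comp (coaction Ψ e G)
  have hρι (j) : ρ (TensorAlgebra.ι k (e j)) = G j ⊗ₜ α (ι Ψ (e j)) := by
    simp [ρ, coaction_ι]
  have hκ (t) : κ (Φ t) = f t := by
    induction t using TensorAlgebra.basis_induction e with
    | one => simp [Φ, orbit_one, κ]; rfl
    | add s t hs ht => simp only [map_add, hs, ht]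
    | smul c t ht => simp only [map_smul, ht]
    | mul j t ht =>
      have h1 (z) : κ (E j z) = (G j ⊗ₜ α (ι Ψ (e j)) + α (ι Ψ (e j)) ⊗ₜ 1) * κ z := by
        induction z using TensorProduct.induction_on with
        | zero => simp
        | add x y hx hy => simp only [mul_add, map_add, hx, hy]
        | tmul b y =>
          have h2 : G j ⊗ₜ[k] α (ι Ψ (e j)) * (α b ⊗ₜ[k] 1) =
              (α (scale hs (p j) b) ⊗ₜ[k] 1) * (G j ⊗ₜ[k] α (ι Ψ (e j))) := by
            simp [comm_scale hs (h j)]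
          simp only [E, κ, LinearMap.add_apply, LinearMap.rTensor_tmul, map_add,
            TensorProduct.map_tmul, LinearMap.comp_apply, LinearMap.mul'_apply,
            AlgHom.toLinearMap_apply, AlgHom.comp_apply, LinearMap.mulLeft_apply,
            Algebra.TensorProduct.includeLeft_apply, add_mul]
          rw [add_comm]
          congr 1
          · rw [← mul_assoc, ← h2, mul_assoc]
          · rw [← mul_assoc, Algebra.TensorProduct.tmul_mul_tmul, mul_one, map_mul]
      rw [map_mul f, hf, ← ht, ← h1, ← orbit_ι_mul]
  have hε (t) : (counit e).toLinearMap.rTensor Y (Φ t) = 1 ⊗ₜ ρ t := by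
    induction t using TensorAlgebra.basis_induction e with
    | one => simp [Φ, orbit_one]
    | add s t hs ht => simp only [map_add, hs, ht, TensorProduct.tmul_add]
    | smul c t ht => simp only [map_smul, ht, TensorProduct.tmul_smul]
    | mul j t ht =>
      have h1 (z) : (counit e).toLinearMap.rTensor Y (E j z) =
          (LinearMap.mulLeft k (G j ⊗ₜ[k] α (ι Ψ (e j)))).lTensor k
            ((counit e).toLinearMap.rTensor Y z) := by
        have h3 (b) : counit e (scale hs (p j) b) = counit e b := by
          have : (counit e).comp (scale hs (p j)) = counit e := hom_ext e fun m => by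
            simp [scale_ι, counit_ι]
          exact congrArg (fun f => f b) this
        induction z using TensorProduct.induction_on with
        | zero => simp
        | add x y hx hy => simp only [map_add, hx, hy]
        | tmul b y => simp [E, counit_ι, h3]
      rw [orbit_ι_mul, h1, ht, map_mul, hρι]
      simp
  have hΦ : ∀ x ∈ nicholsKer Ψ n, Φ x = 0 := by
    -- Both summands of `E j` obey the same Leibniz rule as left multiplication by `e j`, so no
    -- correction is needed and the intertwiner is the identity.
    refine map_nicholsKer_eq_zero_of_deriv hA hA Φ (fun _ => LinearMap.id) (fun i t => ?_)
      (fun n x hx => ?_) n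
    · induction t using TensorAlgebra.basis_induction e with
      | one => simp [leftDeriv_one, Φ, orbit_one, deriv_one]
      | add s t hs ht => simp only [map_add, hs, ht]
      | smul c t ht => simp only [map_smul, ht]
      | mul j t ht =>
        have h1 (z) : (deriv hA i).rTensor Y (E j z) =
            (if i = j then z else 0) + p j i • E j ((deriv hA i).rTensor Y z) := by
          induction z using TensorProduct.induction_on with
          | zero => simp
          | add x y hx hy =>
            simp only [map_add, hx, hy, smul_add]
            split_ifs <;> abel
          | tmul b y =>
            simp only [E, LinearMap.add_apply, LinearMap.rTensor_tmul, map_add,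
              TensorProduct.map_tmul, AlgHom.toLinearMap_apply, LinearMap.mulLeft_apply,
              deriv_ι_mul, deriv_scale, TensorProduct.add_tmul, TensorProduct.smul_tmul', smul_add]
            split_ifs <;> simp [add_assoc]
        rw [orbit_ι_mul, h1, ht, leftDeriv_ι_mul, map_add, map_add, map_smul, map_smul,
          orbit_ι_mul]
        split_ifs <;> simp [Φ]
    · rw [hε]
      simp only [ρ, AlgHom.comp_apply, coaction_nicholsKer hA hG n x hx, map_zero,
        TensorProduct.tmul_zero]
  intro x hx
  rw [← hκ, hΦ x hx, map_zero]

/-- The algebra map `e j ↦ -G j e j` to the opposite algebra respects the relations of the Nichols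
algebra. -/
theorem antipode_nicholsKer (hA : IsAdapted Ψ e p) (hA' : IsAdapted Ψ e p⁻¹)
    (hp : ∀ i j, p i j = p j i) (h0 : ∀ i j, p i j ≠ 0) (hG : ∀ i j, Commute (G i) (G j))
    (h : ∀ i j, α (ι Ψ (e j)) * G i = p i j • (G i * α (ι Ψ (e j))))
    (f : TensorAlgebra k V →ₐ[k] Aᵐᵒᵖ)
    (hf : ∀ j, f (TensorAlgebra.ι k (e j)) = MulOpposite.op (-(G j * α (ι Ψ (e j)))))
    (n : ℕ) : ∀ x ∈ nicholsKer Ψ n, f x = 0 := by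
  have hs : ∃ p, IsAdapted Ψ e p := ⟨p, hA⟩
  have hcomm (i b) : α b * G i = G i * α (scale hs (p i) b) := by
    induction b using basis_induction e with
    | one => simp
    | add s t hs ht => simp only [map_add, mul_add, add_mul, hs, ht]
    | smul c t ht => simp only [map_smul, mul_smul_comm, smul_mul_assoc, ht]
    | mul j t ht =>
      rw [map_mul, mul_assoc, ht, ← mul_assoc, h, map_mul, scale_ι, map_mul, map_smul,
        smul_mul_assoc, smul_mul_assoc, mul_smul_comm, mul_assoc]
  -- Here `b ⊗ a` stands for `a b`. Right multiplication by `-G j e j` first moves `G j` left past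
  -- `b`, which rescales `b` by `p j`.
  let E : I → Module.End k (NicholsAlgebra Ψ ⊗[k] A) := fun j =>
    TensorProduct.map (LinearMap.mulRight k (ι Ψ (e j)) ∘ₗ (scale hs (p j)).toLinearMap)
      (-LinearMap.mulRight k (G j))
  let X : I → Module.End k (NicholsAlgebra Ψ ⊗[k] A) := fun i =>
    TensorProduct.map ((scale hs fun m => p m i).toLinearMap ∘ₗ (scale hs (p i)).toLinearMap)
      (-LinearMap.mulRight k (G i))
  let Φ := orbit e E (1 ⊗ₜ 1)
  let κ : NicholsAlgebra Ψ ⊗[k] A →ₗ[k] A := LinearMap.mul' k A ∘ₗ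
    (TensorProduct.comm k A A).toLinearMap ∘ₗ α.toLinearMap.rTensor A
  have hκ (t) : f t = MulOpposite.op (κ (Φ t)) := by
    induction t using TensorAlgebra.basis_induction e with
    | one => simp [Φ, orbit_one, κ]
    | add s t hs ht => simp only [map_add, hs, ht, MulOpposite.op_add]
    | smul c t ht => simp only [map_smul, ht, MulOpposite.op_smul]
    | mul j t ht =>
      have h1 (z) : κ (E j z) = κ z * -(G j * α (ι Ψ (e j))) := by
        induction z using TensorProduct.induction_on with
        | zero => simp
        | add x y hx hy => simp only [add_mul, map_add, hx, hy]
        | tmul b a =>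
          have h2 : κ (E j (b ⊗ₜ a)) = -(a * G j) * α (scale hs (p j) b * ι Ψ (e j)) := by
            simp [E, κ]
          have h3 : κ (b ⊗ₜ a) = a * α b := by simp [κ]
          rw [h2, h3, map_mul, neg_mul, mul_neg, mul_assoc, ← mul_assoc (G j), ← hcomm]
          simp only [mul_assoc]
      rw [map_mul, hf, ht, ← MulOpposite.op_mul, ← h1, ← orbit_ι_mul]
  have hΦ : ∀ x ∈ nicholsKer Ψ n, Φ x = 0 := by
    -- Reversing words turns `p`-derivations of the image into `p⁻¹`-derivations of the argument, so
    -- both descriptions of the kernel are needed.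
    refine map_nicholsKer_eq_zero_of_deriv hA hA' Φ X (fun i t => ?_) (fun n x hx => ?_) n
    · induction t using TensorAlgebra.basis_induction e with
      | one => simp [leftDeriv_one, Φ, orbit_one, deriv_one]
      | add s t hs ht => simp only [map_add, hs, ht]
      | smul c t ht => simp only [map_smul, ht]
      | mul j t ht =>
        have h1 (z) : (deriv hA i).rTensor A (E j z) =
            (if i = j then X i z else 0) + p j i • E j ((deriv hA i).rTensor A z) := by
          induction z using TensorProduct.induction_on with
          | zero => simp
          | add x y hx hy =>
            simp only [map_add, hx, hy, smul_add]
            split_ifs <;> abel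
          | tmul b y =>
            simp only [E, X, LinearMap.rTensor_tmul, TensorProduct.map_tmul,
              AlgHom.toLinearMap_apply, LinearMap.mulRight_apply, LinearMap.comp_apply,
              deriv_mul_ι, deriv_scale, TensorProduct.add_tmul, TensorProduct.smul_tmul',
              smul_mul_assoc]
            rw [add_comm]
            split_ifs with hij
            · rw [hij]
            · simp
        have h2 (z) : p j i • E j (X i z) = p⁻¹ j i • X i (E j z) := by
          induction z using TensorProduct.induction_on with
          | zero => simp
          | add x y hx hy => simp only [map_add, hx, hy, smul_add]
          | tmul b y =>
            simp only [E, X, TensorProduct.map_tmul, AlgHom.toLinearMap_apply,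
              LinearMap.mulRight_apply, LinearMap.comp_apply, map_mul, scale_ι, scale_scale,
              LinearMap.neg_apply, mul_assoc, (hG i j).eq, neg_mul, neg_neg, map_smul,
              mul_smul_comm, ← TensorProduct.smul_tmul', smul_smul]
            congr 2
            · rw [hp i j, Pi.inv_apply, Pi.inv_apply, inv_mul_cancel_left₀ (h0 j i)]
            · rw [mul_comm, mul_assoc, mul_left_comm]
        rw [orbit_ι_mul, h1, ht, leftDeriv_ι_mul, map_add, map_add, map_smul, map_smul,
          orbit_ι_mul, h2]
        split_ifs <;> simp [Φ]
    · refine map_nicholsKer_eq_zero (f := (counit e).toLinearMap.rTensor A ∘ₗ Φ) e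
        (fun j t => ?_) hx
      rw [LinearMap.comp_apply, orbit_ι_mul]
      induction orbit e E (1 ⊗ₜ 1) t using TensorProduct.induction_on with
      | zero => simp
      | add x y hx hy => simp only [map_add, hx, hy, add_zero]
      | tmul b a => simp [E, counit_ι]
  intro x hx
  rw [hκ, hΦ x hx, map_zero, MulOpposite.op_zero]

end Coaction

end NicholsAlgebra

end

noncomputable section

/-! ## Generators and relations of the double bosonization -/

section DiagonalDoubleBosonization

variable {k Γ X : Type*} [Field k] [CommGroup Γ] [AddCommGroup X] [Module k X]
  [FiniteDimensional k X] {θ : ℕ}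

/-- The Yetter–Drinfeld module is of diagonal type with symmetric braiding matrix `q`, and
`qᵢⱼ = χⱼ(gᵢ)`. -/
structure IsSymmetricDiagonal (D : YetterDrinfeld k Γ X) (F : Module.Basis (Fin θ) k X)
    (g : Fin θ → Γ) (χ : Fin θ → Γ →* kˣ) (q : Fin θ → Fin θ → k) : Prop where
  braiding : D.braiding = diagBraiding F q
  symm : ∀ i j, q i j = q j i
  eq_char : ∀ i j, q i j = χ j (g i)

variable {D : YetterDrinfeld k Γ X} {F : Module.Basis (Fin θ) k X} {g : Fin θ → Γ}
  {χ : Fin θ → Γ →* kˣ} {q : Fin θ → Fin θ → k}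

set_option linter.unusedSectionVars false

theorem YetterDrinfeld.braiding_tmul
    (hcoact : ∀ i, D.coact (F i) = MonoidAlgebra.of k Γ (g i) ⊗ₜ[k] F i)
    (hact : ∀ γ i, D.act γ (F i) = (χ i γ : k) • F i) (i j : Fin θ) :
    D.braiding (F i ⊗ₜ F j) = (χ j (g i) : k) • (F j ⊗ₜ[k] F i) := by
  simp [YetterDrinfeld.braiding, hcoact, hact, TensorProduct.smul_tmul']

/-- Since the pairing is nested, the matrix comes out as `q` and not as its transpose; symmetry
plays no role here. -/
theorem dualBraiding_diagBraiding (e : Module.Basis (Fin θ) k X) (q : Fin θ → Fin θ → k) :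
    dualBraiding (diagBraiding e q) = diagBraiding e.dualBasis q := by
  refine eq_diagBraiding _ fun i j => ?_
  rw [dualBraiding, LinearMap.comp_apply, LinearMap.comp_apply, LinearEquiv.coe_coe,
    LinearEquiv.coe_coe, LinearEquiv.symm_apply_eq, map_smul]
  refine (e.tensorProduct e).ext fun ab => ?_
  obtain ⟨a, b⟩ := ab
  rw [Module.Basis.tensorProduct_apply]
  simp only [nestedPairing, LinearEquiv.trans_apply, TensorProduct.comm_tmul,
    LinearMap.dualMap_apply, diagBraiding_tmul, map_smul, LinearMap.smul_apply,
    TensorProduct.dualDistribEquiv, TensorProduct.dualDistribEquivOfBasis_apply_apply,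
    smul_eq_mul]
  by_cases ha : a = i
  · by_cases hb : b = j
    · simp [ha, hb]
    · simp [hb]
  · simp [ha]

namespace IsSymmetricDiagonal

variable (h : IsSymmetricDiagonal D F g χ q)
include h

theorem ne_zero (i j : Fin θ) : q i j ≠ 0 := by
  rw [h.eq_char]
  exact Units.ne_zero _

theorem isAdapted : IsAdapted D.braiding F q := by
  rw [h.braiding]
  exact isAdapted_diagBraiding F q

theorem isAdapted_dual : IsAdapted (dualBraiding D.braiding) F.dualBasis q := by
  rw [h.braiding, dualBraiding_diagBraiding F q]
  exact isAdapted_diagBraiding _ q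

theorem isAdapted_inv : IsAdapted D.braiding F q⁻¹ := h.isAdapted.inv h.symm h.ne_zero

theorem isAdapted_dual_inv : IsAdapted (dualBraiding D.braiding) F.dualBasis q⁻¹ :=
  h.isAdapted_dual.inv h.symm h.ne_zero

theorem exists_isAdapted : ∃ p, IsAdapted D.braiding F p := ⟨q, h.isAdapted⟩

theorem exists_isAdapted_dual : ∃ p, IsAdapted (dualBraiding D.braiding) F.dualBasis p :=
  ⟨q, h.isAdapted_dual⟩

end IsSymmetricDiagonal

/-! ### Maps out of `𝔘` and relations inside it -/

namespace DoubleBosonization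

variable (D F g χ q)

/-- Algebra maps out of the double bosonization are given by images of the generators that satisfy
the defining relations. -/
def liftGen {A : Type*} [Ring A] [Algebra k A] (a b : Fin θ → A) (c : Γ →* A)
    (ha : ∀ n, ∀ x ∈ nicholsKer D.braiding n, TensorAlgebra.lift k (F.constr k a) x = 0)
    (hb : ∀ n, ∀ x ∈ nicholsKer (dualBraiding D.braiding) n,
      TensorAlgebra.lift k (F.dualBasis.constr k b) x = 0)
    (hca : ∀ γ j, c γ * a j = (χ j γ : k) • (a j * c γ))
    (hcb : ∀ γ j, c γ * b j = (χ j γ : k)⁻¹ • (b j * c γ))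
    (hba : ∀ i j, b i * a j - q j i • (a j * b i) = if i = j then 1 - c (g j) ^ 2 else 0) :
    DoubleBosonization D F g χ q →ₐ[k] A :=
  RingQuot.liftAlgHom k ⟨FreeAlgebra.lift k fun
    | .F i => a i
    | .Fbar i => b i
    | .G γ => c γ, by
      intro x y hxy
      cases hxy with
      | one => simp
      | mul => simp
      | conj γ j => simp [hca]
      | conjDual γ j => simp [hcb]
      | cross i j =>
        simp only [map_sub, map_mul, map_smul, FreeAlgebra.lift_ι_apply, hba]
        split_ifs <;> simp
      | nichols x y hxy =>
        rw [← AlgHom.comp_apply, ← AlgHom.comp_apply]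
        refine NicholsAlgebra.rel_eq_of_nicholsKer (fun n x hx => ?_) x y hxy
        rw [← ha n x hx]
        refine DFunLike.congr_fun (TensorAlgebra.hom_ext (F.ext fun i => ?_)) x
        simp [freeOfTensor]
      | nicholsDual x y hxy =>
        rw [← AlgHom.comp_apply, ← AlgHom.comp_apply]
        refine NicholsAlgebra.rel_eq_of_nicholsKer (fun n x hx => ?_) x y hxy
        rw [← hb n x hx]
        refine DFunLike.congr_fun (TensorAlgebra.hom_ext (F.dualBasis.ext fun i => ?_)) x
        simp [freeOfTensorDual, -Module.Basis.coe_dualBasis]⟩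

section Lift

variable {D F g χ q} {A : Type*} [Ring A] [Algebra k A] {a b : Fin θ → A} {c : Γ →* A}
    (ha : ∀ n, ∀ x ∈ nicholsKer D.braiding n, TensorAlgebra.lift k (F.constr k a) x = 0)
    (hb : ∀ n, ∀ x ∈ nicholsKer (dualBraiding D.braiding) n,
      TensorAlgebra.lift k (F.dualBasis.constr k b) x = 0)
    (hca : ∀ γ j, c γ * a j = (χ j γ : k) • (a j * c γ))
    (hcb : ∀ γ j, c γ * b j = (χ j γ : k)⁻¹ • (b j * c γ))
    (hba : ∀ i j, b i * a j - q j i • (a j * b i) = if i = j then 1 - c (g j) ^ 2 else 0)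

theorem liftGen_gen (i : Fin θ) :
    liftGen D F g χ q a b c ha hb hca hcb hba (gen D F g χ q i) = a i :=
  (RingQuot.liftAlgHom_mkAlgHom_apply _ _ _ _).trans (FreeAlgebra.lift_ι_apply _ _)

theorem liftGen_genBar (i : Fin θ) :
    liftGen D F g χ q a b c ha hb hca hcb hba (genBar D F g χ q i) = b i :=
  (RingQuot.liftAlgHom_mkAlgHom_apply _ _ _ _).trans (FreeAlgebra.lift_ι_apply _ _)

theorem liftGen_grp (γ : Γ) :
    liftGen D F g χ q a b c ha hb hca hcb hba (grp D F g χ q γ) = c γ :=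
  (RingQuot.liftAlgHom_mkAlgHom_apply _ _ _ _).trans (FreeAlgebra.lift_ι_apply _ _)

end Lift

variable {D F g χ q}

theorem gen_induction {P : DoubleBosonization D F g χ q → Prop}
    (algebraMap : ∀ c, P (algebraMap k _ c)) (gen : ∀ i, P (gen D F g χ q i))
    (genBar : ∀ i, P (genBar D F g χ q i)) (grp : ∀ γ, P (grp D F g χ q γ))
    (add : ∀ u v, P u → P v → P (u + v)) (mul : ∀ u v, P u → P v → P (u * v))
    (u : DoubleBosonization D F g χ q) : P u := by
  obtain ⟨x, rfl⟩ := RingQuot.mkAlgHom_surjective k (DBRel D F g χ q) u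
  change P (mk D F g χ q x)
  induction x using FreeAlgebra.induction with
  | grade0 r => rw [AlgHom.commutes]; exact algebraMap r
  | grade1 x =>
    cases x with
    | F i => exact gen i
    | Fbar i => exact genBar i
    | G γ => exact grp γ
  | add a b ha hb => rw [map_add]; exact add _ _ ha hb
  | mul a b ha hb => rw [map_mul]; exact mul _ _ ha hb

theorem hom_ext {A : Type*} [Semiring A] [Algebra k A]
    {f f' : DoubleBosonization D F g χ q →ₐ[k] A}
    (gen : ∀ i, f (gen D F g χ q i) = f' (gen D F g χ q i))
    (genBar : ∀ i, f (genBar D F g χ q i) = f' (genBar D F g χ q i))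
    (grp : ∀ γ, f (grp D F g χ q γ) = f' (grp D F g χ q γ)) : f = f' := by
  refine AlgHom.ext fun u => ?_
  induction u using gen_induction with
  | algebraMap c => rw [AlgHom.commutes, AlgHom.commutes]
  | gen i => exact gen i
  | genBar i => exact genBar i
  | grp γ => exact grp γ
  | add u v hu hv => rw [map_add, map_add, hu, hv]
  | mul u v hu hv => rw [map_mul, map_mul, hu, hv]

variable (D F g χ q)

theorem grp_mul_gen (γ : Γ) (j : Fin θ) : grp D F g χ q γ * gen D F g χ q j =
    (χ j γ : k) • (gen D F g χ q j * grp D F g χ q γ) := by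
  have := mk_rel D F g χ q (.conj γ j)
  rwa [map_smul, map_mul, map_mul] at this

theorem grp_mul_genBar (γ : Γ) (j : Fin θ) : grp D F g χ q γ * genBar D F g χ q j =
    (χ j γ : k)⁻¹ • (genBar D F g χ q j * grp D F g χ q γ) := by
  have := mk_rel D F g χ q (.conjDual γ j)
  rwa [map_smul, map_mul, map_mul] at this

theorem genBar_mul_gen (i j : Fin θ) : genBar D F g χ q i * gen D F g χ q j -
    q j i • (gen D F g χ q j * genBar D F g χ q i) =
      if i = j then 1 - grp D F g χ q (g j) ^ 2 else 0 := by
  have := mk_rel D F g χ q (.cross i j)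
  rw [map_sub, map_smul, map_mul, map_mul] at this
  refine this.trans ?_
  split_ifs
  · rw [map_sub, map_one, map_pow]; rfl
  · rw [map_zero]

theorem ofNichols_ι (i : Fin θ) :
    ofNichols D F g χ q (NicholsAlgebra.ι D.braiding (F i)) = gen D F g χ q i := by
  refine (NicholsAlgebra.lift_ι _ _ _).trans ?_
  simp [freeOfTensor, gen]

theorem ofNicholsDual_ι (i : Fin θ) :
    ofNicholsDual D F g χ q (NicholsAlgebra.ι (dualBraiding D.braiding) (F.dualBasis i)) =
      genBar D F g χ q i := by
  refine (NicholsAlgebra.lift_ι _ _ _).trans ?_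
  simp [freeOfTensorDual, genBar, -Module.Basis.coe_dualBasis]

theorem grp_mul_grp_inv (γ : Γ) : grp D F g χ q γ * grp D F g χ q γ⁻¹ = 1 := by
  rw [← map_mul, mul_inv_cancel, map_one]

/-! ### Straightening -/

theorem mulMap_tmul (b' : NicholsAlgebra (dualBraiding D.braiding)) (b : NicholsAlgebra D.braiding)
    (s : MonoidAlgebra k Γ) : mulMap D F g χ q ((b' ⊗ₜ b) ⊗ₜ s) =
      ofNicholsDual D F g χ q b' * ofNichols D F g χ q b *
        MonoidAlgebra.lift k (DoubleBosonization D F g χ q) Γ (grp D F g χ q) s := rfl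

theorem mul_mem_range_mulMap (b' : NicholsAlgebra (dualBraiding D.braiding))
    (b : NicholsAlgebra D.braiding) (γ : Γ) :
    ofNicholsDual D F g χ q b' * ofNichols D F g χ q b * grp D F g χ q γ ∈
      LinearMap.range (mulMap D F g χ q) :=
  ⟨(b' ⊗ₜ b) ⊗ₜ MonoidAlgebra.of k Γ γ, by simp [mulMap_tmul]⟩

variable {D F g χ q}

theorem mul_mem_range_mulMap_of {u : DoubleBosonization D F g χ q}
    (h : ∀ b' b γ, u * (ofNicholsDual D F g χ q b' * ofNichols D F g χ q b * grp D F g χ q γ) ∈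
      LinearMap.range (mulMap D F g χ q)) {z : DoubleBosonization D F g χ q}
    (hz : z ∈ LinearMap.range (mulMap D F g χ q)) : u * z ∈ LinearMap.range (mulMap D F g χ q) := by
  obtain ⟨y, rfl⟩ := hz
  induction y using TensorProduct.induction_on with
  | zero => simp
  | add x y hx hy => rw [map_add, mul_add]; exact add_mem hx hy
  | tmul y s =>
    induction y using TensorProduct.induction_on with
    | zero => simp
    | add x y hx hy => rw [TensorProduct.add_tmul, map_add, mul_add]; exact add_mem hx hy
    | tmul b' b =>
      induction s using MonoidAlgebra.induction_on with
      | of γ => simpa [mulMap_tmul] using h b' b γ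
      | add s t hs ht => rw [TensorProduct.tmul_add, map_add, mul_add]; exact add_mem hs ht
      | smul c s hs =>
        rw [TensorProduct.tmul_smul, map_smul, mul_smul_comm]; exact Submodule.smul_mem _ _ hs

section

variable (h : IsSymmetricDiagonal D F g χ q)
include h

theorem grp_mul_ofNichols (γ : Γ) (b : NicholsAlgebra D.braiding) :
    grp D F g χ q γ * ofNichols D F g χ q b =
      ofNichols D F g χ q (NicholsAlgebra.scale h.exists_isAdapted (fun j => (χ j γ : k)) b) *
        grp D F g χ q γ :=
  NicholsAlgebra.comm_scale _ (fun j => by rw [ofNichols_ι, grp_mul_gen]) b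

theorem grp_mul_ofNicholsDual (γ : Γ) (b : NicholsAlgebra (dualBraiding D.braiding)) :
    grp D F g χ q γ * ofNicholsDual D F g χ q b =
      ofNicholsDual D F g χ q
        (NicholsAlgebra.scale h.exists_isAdapted_dual (fun j => (χ j γ : k)⁻¹) b) *
          grp D F g χ q γ :=
  NicholsAlgebra.comm_scale _ (fun j => by rw [ofNicholsDual_ι, grp_mul_genBar]) b

/-- The range contains `1` and is stable under left multiplication by every generator. Only `Fⱼ`
needs an argument: it is moved through the `𝔅(X*)` factor one letter at a time. -/
theorem mulMap_surjective : Function.Surjective (mulMap D F g χ q) := by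
  set S := LinearMap.range (mulMap D F g χ q)
  have hgrp (γ : Γ) : ∀ z ∈ S, grp D F g χ q γ * z ∈ S := fun z hz =>
    mul_mem_range_mulMap_of (fun b' b γ' => by
      rw [← mul_assoc, ← mul_assoc, grp_mul_ofNicholsDual h, mul_assoc (ofNicholsDual D F g χ q _),
        grp_mul_ofNichols h, ← mul_assoc, mul_assoc _ (grp D F g χ q γ), ← map_mul]
      exact mul_mem_range_mulMap ..) hz
  have hbar (i : Fin θ) : ∀ z ∈ S, genBar D F g χ q i * z ∈ S := fun z hz =>
    mul_mem_range_mulMap_of (fun b' b γ => by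
      rw [← mul_assoc, ← mul_assoc, ← ofNicholsDual_ι, ← map_mul]
      exact mul_mem_range_mulMap ..) hz
  have hgen (j : Fin θ) : ∀ z ∈ S, gen D F g χ q j * z ∈ S := fun z hz =>
    mul_mem_range_mulMap_of (fun b' b γ => by
      induction b' using NicholsAlgebra.basis_induction F.dualBasis with
      | one =>
        rw [map_one, one_mul, ← mul_assoc, ← ofNichols_ι, ← map_mul]
        simpa using mul_mem_range_mulMap D F g χ q 1 (NicholsAlgebra.ι D.braiding (F j) * b) γ
      | add s t hs ht => rw [map_add, add_mul, add_mul, mul_add]; exact add_mem hs ht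
      | smul c t ht =>
        rw [map_smul, smul_mul_assoc, smul_mul_assoc, mul_smul_comm]
        exact Submodule.smul_mem _ _ ht
      | mul i t ht =>
        set z := ofNicholsDual D F g χ q t * ofNichols D F g χ q b * grp D F g χ q γ with hz
        have hzS : z ∈ S := mul_mem_range_mulMap ..
        -- The cross relation solved for `Fⱼ F̄ᵢ`; the correction term lies in `kΓ`, which already
        -- preserves the range.
        have h1 : gen D F g χ q j * genBar D F g χ q i = (q j i)⁻¹ •
            (genBar D F g χ q i * gen D F g χ q j -
              if i = j then 1 - grp D F g χ q (g j) ^ 2 else 0) := by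
          rw [← genBar_mul_gen, sub_sub_cancel, smul_smul, inv_mul_cancel₀ (h.ne_zero j i),
            one_smul]
        have h2 : gen D F g χ q j * (ofNicholsDual D F g χ q
            (NicholsAlgebra.ι (dualBraiding D.braiding) (F.dualBasis i) * t) *
              ofNichols D F g χ q b * grp D F g χ q γ) =
            gen D F g χ q j * genBar D F g χ q i * z := by
          rw [map_mul, ofNicholsDual_ι, hz]
          simp only [mul_assoc]
        rw [h2, h1, smul_mul_assoc, sub_mul, mul_assoc]
        refine Submodule.smul_mem _ _ (sub_mem (hbar i _ ht) ?_)
        split_ifs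
        · rw [sub_mul, one_mul, pow_two, mul_assoc]
          exact sub_mem hzS (hgrp _ _ (hgrp _ _ hzS))
        · rw [zero_mul]; exact zero_mem _) hz
  have key (u : DoubleBosonization D F g χ q) : ∀ z ∈ S, u * z ∈ S := by
    induction u using gen_induction with
    | algebraMap c =>
      intro z hz
      rw [← Algebra.smul_def]
      exact Submodule.smul_mem _ _ hz
    | gen i => exact hgen i
    | genBar i => exact hbar i
    | grp γ => exact hgrp γ
    | add u v hu hv => intro z hz; rw [add_mul]; exact add_mem (hu z hz) (hv z hz)
    | mul u v hu hv => intro z hz; rw [mul_assoc]; exact hu _ (hv z hz)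
  intro u
  have h1 := mul_mem_range_mulMap D F g χ q 1 1 1
  rw [map_one, map_one, map_one, mul_one, mul_one] at h1
  have := key u 1 h1
  rwa [mul_one] at this

end

end DoubleBosonization

end DiagonalDoubleBosonization

end

noncomputable section

/-! ## Induced modules of the double bosonization -/

namespace DoubleBosonization

set_option linter.unusedSectionVars false

variable {k Γ X : Type*} [Field k] [CommGroup Γ] [AddCommGroup X] [Module k X]
  [FiniteDimensional k X] {θ : ℕ} {D : YetterDrinfeld k Γ X} {F : Module.Basis (Fin θ) k X}
  {g : Fin θ → Γ} {χ : Fin θ → Γ →* kˣ} {q : Fin θ → Fin θ → k}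

/-- Commuting an element that satisfies the cross relations past a product of generators. -/
theorem mul_tensorHom_eq {V I E : Type*} [AddCommGroup V] [Module k V] [DecidableEq I]
    (e : Module.Basis I k V) {p : I → I → k} (hp : ∀ i j, p i j = p j i) (h0 : ∀ i j, p i j ≠ 0)
    [Ring E] [Algebra k E] (f : TensorAlgebra k V →ₐ[k] E) {β γ : E} {i : I}
    (h1 : ∀ m, β * f (TensorAlgebra.ι k (e m)) - p m i • (f (TensorAlgebra.ι k (e m)) * β) =
      if i = m then 1 - γ ^ 2 else 0)
    (h2 : ∀ m, γ * f (TensorAlgebra.ι k (e m)) = p m i • (f (TensorAlgebra.ι k (e m)) * γ))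
    (t : TensorAlgebra k V) :
    β * f t = f (tensorScale e (p i) t) * β + f (leftDeriv e p i t) -
      γ ^ 2 * f (leftDeriv e p⁻¹ i t) := by
  induction t using TensorAlgebra.basis_induction e with
  | one => simp [leftDeriv_one]
  | add s t hs ht => simp only [map_add, mul_add, add_mul, hs, ht]; abel
  | smul r t ht =>
    simp only [map_smul, mul_smul_comm, smul_mul_assoc, ht, smul_sub, smul_add]
  | mul m t ht =>
    -- Crossing `γ ^ 2` contributes `(p m i)⁻²`, which turns the Leibniz factor `p m i` into `(p m
    -- i)⁻¹`. Hence the second derivation is the one for `p⁻¹`.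
    have h3 : f (TensorAlgebra.ι k (e m)) * γ ^ 2 =
        ((p m i)⁻¹ * (p m i)⁻¹) • (γ ^ 2 * f (TensorAlgebra.ι k (e m))) := by
      have h3 : f (TensorAlgebra.ι k (e m)) * γ =
          (p m i)⁻¹ • (γ * f (TensorAlgebra.ι k (e m))) := by
        rw [h2, smul_smul, inv_mul_cancel₀ (h0 m i), one_smul]
      rw [pow_two, ← mul_assoc, h3, smul_mul_assoc, mul_assoc, h3, mul_smul_comm, smul_smul,
        mul_assoc]
    have h4 : p m i * ((p m i)⁻¹ * (p m i)⁻¹) = (p m i)⁻¹ := by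
      rw [← mul_assoc, mul_inv_cancel₀ (h0 m i), one_mul]
    rw [map_mul, ← mul_assoc, sub_eq_iff_eq_add'.1 (h1 m), add_mul, smul_mul_assoc, mul_assoc, ht,
      leftDeriv_ι_mul, leftDeriv_ι_mul, map_mul, tensorScale_ι, smul_mul_assoc, map_smul, map_mul,
      map_add, map_add, map_smul, map_smul, map_mul, map_mul, mul_sub, mul_add,
      ← mul_assoc _ (γ ^ 2), h3, hp i m, smul_sub, smul_mul_assoc, smul_smul, h4]
    simp only [Pi.inv_apply, mul_add, mul_smul_comm, smul_add, smul_mul_assoc, mul_assoc]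
    by_cases him : i = m
    · subst him
      simp only [if_true, sub_mul, one_mul]
      abel
    · simp only [him, if_false, zero_mul, map_zero, mul_zero]
      abel

/-! ### The module `𝔅(X*) ⊗ W` induced from a module `W` over `𝔅(X) # kΓ` -/

section Induced

open NicholsAlgebra

variable (h : IsSymmetricDiagonal D F g χ q) {W : Type*} [AddCommGroup W] [Module k W]
  (a : NicholsAlgebra D.braiding →ₐ[k] Module.End k W) (c : Γ →* Module.End k W)
  (hac : ∀ γ j, c γ * a (ι D.braiding (F j)) = (χ j γ : k) • (a (ι D.braiding (F j)) * c γ))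

/-- The action of `Γ` on the induced module `𝔅(X*) ⊗ W`. -/
def inducedGrp : Γ →* Module.End k (NicholsAlgebra (dualBraiding D.braiding) ⊗[k] W) where
  toFun γ := TensorProduct.map
    (scale h.exists_isAdapted_dual fun j => (χ j γ : k)⁻¹).toLinearMap (c γ)
  map_one' := TensorProduct.ext' fun b w => by
    have : (fun j => ((χ j 1 : kˣ) : k)⁻¹) = 1 := by ext; simp
    rw [TensorProduct.map_tmul, AlgHom.toLinearMap_apply, this, scale_one, map_one]
    rfl
  map_mul' γ δ := TensorProduct.ext' fun b w => by
    have : (fun j => ((χ j (γ * δ) : kˣ) : k)⁻¹) =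
        (fun j => (χ j γ : k)⁻¹) * fun j => (χ j δ : k)⁻¹ := by ext; simp [mul_comm]
    simp only [TensorProduct.map_tmul, Module.End.mul_apply, AlgHom.toLinearMap_apply, scale_scale,
      map_mul c, this]

theorem inducedGrp_tmul (γ : Γ) (b : NicholsAlgebra (dualBraiding D.braiding)) (w : W) :
    inducedGrp h c γ (b ⊗ₜ w) =
      scale h.exists_isAdapted_dual (fun j => (χ j γ : k)⁻¹) b ⊗ₜ c γ w := rfl

/-- The action of `𝔅(X*)` on the induced module `𝔅(X*) ⊗ W`. -/
def inducedBar (Ψ : Module.Dual k X ⊗[k] Module.Dual k X →ₗ[k] Module.Dual k X ⊗[k] Module.Dual k X)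
    (W : Type*) [AddCommGroup W] [Module k W] :
    NicholsAlgebra Ψ →ₐ[k] Module.End k (NicholsAlgebra Ψ ⊗[k] W) :=
  (Module.End.rTensorAlgHom k _ W).comp (Algebra.lmul k _)

theorem inducedBar_tmul (b' b : NicholsAlgebra (dualBraiding D.braiding)) (w : W) :
    inducedBar _ W b' (b ⊗ₜ w) = (b' * b) ⊗ₜ w := rfl

/-- The action of `F j` on the induced module `𝔅(X*) ⊗ W`. -/
def inducedGen (j : Fin θ) : Module.End k (NicholsAlgebra (dualBraiding D.braiding) ⊗[k] W) :=
  -- The formula obtained by repeatedly moving `Fⱼ` right through `b` with `Fⱼ F̄ᵢ = q_{ji}⁻¹ (F̄ᵢ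
  -- Fⱼ - δᵢⱼ (1 - gⱼ²))`. The terms with `1` add up to the `q⁻¹`-derivative, those with `gⱼ²`,
  -- moved to the front, to the `q`-derivative.
  TensorProduct.map (scale h.exists_isAdapted_dual fun m => (χ m (g j) : k)⁻¹).toLinearMap
      (a (ι D.braiding (F j))) -
    (q j j)⁻¹ • ((deriv h.isAdapted_dual_inv j).rTensor W -
      inducedGrp h c (g j) ^ 2 * (deriv h.isAdapted_dual j).rTensor W)

theorem inducedGen_tmul (j : Fin θ) (b : NicholsAlgebra (dualBraiding D.braiding)) (w : W) :
    inducedGen h a c j (b ⊗ₜ w) =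
      scale h.exists_isAdapted_dual (fun m => (χ m (g j) : k)⁻¹) b ⊗ₜ a (ι D.braiding (F j)) w -
      (q j j)⁻¹ • (deriv h.isAdapted_dual_inv j b ⊗ₜ w -
        (inducedGrp h c (g j) ^ 2) (deriv h.isAdapted_dual j b ⊗ₜ w)) := rfl

theorem inducedGrp_mul_bar (γ : Γ) (i : Fin θ) :
    inducedGrp h c γ * inducedBar _ W (ι _ (F.dualBasis i)) =
      (χ i γ : k)⁻¹ • (inducedBar _ W (ι _ (F.dualBasis i)) * inducedGrp h c γ) :=
  TensorProduct.ext' fun b w => by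
    rw [Module.End.mul_apply, inducedBar_tmul, inducedGrp_tmul, map_mul, scale_ι,
      LinearMap.smul_apply, Module.End.mul_apply, inducedGrp_tmul, inducedBar_tmul,
      smul_mul_assoc, TensorProduct.smul_tmul']

include hac in
-- On `𝔅(X*)` the group acts through inverse characters, so removing one `F̄ⱼ` changes the weight by
-- `χ j`, exactly as the action of `Fⱼ` on `W` does.
theorem inducedGrp_mul_gen (γ : Γ) (j : Fin θ) :
    inducedGrp h c γ * inducedGen h a c j =
      (χ j γ : k) • (inducedGen h a c j * inducedGrp h c γ) :=
  TensorProduct.ext' fun b w => by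
    have hac' : c γ (a (ι D.braiding (F j)) w) = (χ j γ : k) • a (ι D.braiding (F j)) (c γ w) :=
      congrArg (fun f => f w) (hac γ j)
    have hcomm (z) : inducedGrp h c γ ((inducedGrp h c (g j) ^ 2) z) =
        (inducedGrp h c (g j) ^ 2) (inducedGrp h c γ z) := by
      rw [← Module.End.mul_apply, ← Module.End.mul_apply, ← map_pow, ← map_mul, ← map_mul,
        mul_comm]
    have hχ : (χ j γ : k) * (χ j γ : k)⁻¹ = 1 := mul_inv_cancel₀ (Units.ne_zero _)
    rw [LinearMap.smul_apply, Module.End.mul_apply, Module.End.mul_apply, inducedGrp_tmul,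
      inducedGen_tmul, inducedGen_tmul, map_sub, map_smul, map_sub, hcomm, inducedGrp_tmul,
      inducedGrp_tmul, inducedGrp_tmul, hac', deriv_scale, deriv_scale, scale_scale, scale_scale,
      mul_comm (fun m => (χ m γ : k)⁻¹)]
    simp only [← TensorProduct.smul_tmul', map_smul, TensorProduct.tmul_smul, smul_sub]
    simp only [smul_smul, mul_left_comm (χ j γ : k), hχ, mul_one]

/-- The Leibniz terms `δᵢⱼ` of the two derivations give `1` and `gⱼ²`. The remaining terms cancel,
since moving `gⱼ²` past `F̄ᵢ` costs `q_{ji}⁻²` and so makes up for the difference between the rules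
for `q` and `q⁻¹`. -/
theorem inducedBar_mul_gen (i j : Fin θ) :
    inducedBar _ W (ι _ (F.dualBasis i)) * inducedGen h a c j -
        q j i • (inducedGen h a c j * inducedBar _ W (ι _ (F.dualBasis i))) =
      if i = j then 1 - inducedGrp h c (g j) ^ 2 else 0 :=
  TensorProduct.ext' fun b w => by
    have hG (z) : (inducedGrp h c (g j) ^ 2) (inducedBar _ W (ι _ (F.dualBasis i)) z) =
        ((q j i)⁻¹ * (q j i)⁻¹) •
          inducedBar _ W (ι _ (F.dualBasis i)) ((inducedGrp h c (g j) ^ 2) z) := by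
      have := inducedGrp_mul_bar h c (g j) i
      rw [← h.eq_char] at this
      have h2 (z) : inducedGrp h c (g j) (inducedBar _ W (ι _ (F.dualBasis i)) z) =
          (q j i)⁻¹ • inducedBar _ W (ι _ (F.dualBasis i)) (inducedGrp h c (g j) z) :=
        congrArg (fun f => f z) this
      rw [pow_two, Module.End.mul_apply, Module.End.mul_apply, h2, map_smul, h2, smul_smul]
    have hq := h.ne_zero j i
    rw [LinearMap.sub_apply, LinearMap.smul_apply, Module.End.mul_apply, Module.End.mul_apply,
      inducedBar_tmul, inducedGen_tmul, inducedGen_tmul, deriv_ι_mul, deriv_ι_mul, map_mul,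
      scale_ι, ← h.eq_char, map_sub, map_smul, map_sub, inducedBar_tmul, inducedBar_tmul]
    simp only [TensorProduct.add_tmul, map_add, smul_mul_assoc, ← TensorProduct.smul_tmul',
      map_smul, ← inducedBar_tmul (D := D), hG, Pi.inv_apply, h.symm i j, smul_sub, smul_add,
      smul_smul]
    rw [mul_inv_cancel₀ hq, one_smul, mul_left_comm (q j i) (q j j)⁻¹ (q j i)⁻¹,
      mul_inv_cancel₀ hq, mul_one]
    have h3 : q j i * ((q j j)⁻¹ * (q j i * ((q j i)⁻¹ * (q j i)⁻¹))) = (q j j)⁻¹ := by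
      field_simp
    rw [h3]
    by_cases hij : i = j
    · subst hij
      simp only [if_true, mul_inv_cancel₀ hq, one_smul, LinearMap.sub_apply, Module.End.one_apply]
      abel
    · simp [hij, Ne.symm hij]

/-- The action of `T(X)` on the induced module `𝔅(X*) ⊗ W`. -/
def inducedTensor :
    TensorAlgebra k X →ₐ[k] Module.End k (NicholsAlgebra (dualBraiding D.braiding) ⊗[k] W) :=
  TensorAlgebra.lift k (F.constr k (inducedGen h a c))

theorem inducedTensor_ι (j : Fin θ) :
    inducedTensor h a c (TensorAlgebra.ι k (F j)) = inducedGen h a c j := by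
  simp [inducedTensor]

/-- Both derivations vanish at `1`, so `1 ⊗ W` is a copy of `W`. -/
theorem inducedTensor_one_tmul (t : TensorAlgebra k X) (w : W) :
    inducedTensor h a c t (1 ⊗ₜ w) = 1 ⊗ₜ a (NicholsAlgebra.mk _ t) w := by
  induction t using TensorAlgebra.basis_induction F with
  | one => simp
  | add s t hs ht => simp only [map_add, LinearMap.add_apply, hs, ht, TensorProduct.tmul_add]
  | smul r t ht => simp only [map_smul, LinearMap.smul_apply, ht, TensorProduct.tmul_smul]
  | mul j t ht =>
    rw [map_mul, Module.End.mul_apply, ht, inducedTensor_ι, inducedGen_tmul,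
      NicholsAlgebra.deriv_one, NicholsAlgebra.deriv_one,
      map_one]
    simp [mk_ι]

include hac in
theorem inducedBar_mul_tensor (i : Fin θ) (t : TensorAlgebra k X) :
    inducedBar _ W (ι _ (F.dualBasis i)) * inducedTensor h a c t =
      inducedTensor h a c (tensorScale F (q i) t) * inducedBar _ W (ι _ (F.dualBasis i)) +
      inducedTensor h a c (leftDeriv F q i t) -
      inducedGrp h c (g i) ^ 2 * inducedTensor h a c (leftDeriv F q⁻¹ i t) := by
  refine mul_tensorHom_eq (E := Module.End k (NicholsAlgebra (dualBraiding D.braiding) ⊗[k] W))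
    F h.symm h.ne_zero (inducedTensor h a c) (fun m => ?_) (fun m => ?_) t
  · rw [inducedTensor_ι]
    refine (inducedBar_mul_gen h a c i m).trans ?_
    split_ifs with hm
    · rw [hm]
    · rfl
  · rw [inducedTensor_ι, inducedGrp_mul_gen h a c hac, ← h.eq_char, h.symm]

include hac in
-- Induction on the `𝔅(X*)` factor, for all degrees at once. On `1 ⊗ W` the relations hold because
-- they hold on `W`. To pass from `b` to `F̄ᵢ b`, commute `F̄ᵢ` to the front: the elements left to
-- act on `b` are relations again, since the kernels are adapted to both `q` and `q⁻¹`.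
theorem inducedTensor_nicholsKer (n : ℕ) : ∀ x ∈ nicholsKer D.braiding n,
    inducedTensor h a c x = 0 := by
  suffices ∀ (b : NicholsAlgebra (dualBraiding D.braiding)) (w : W) (n : ℕ),
      ∀ x ∈ nicholsKer D.braiding n, inducedTensor h a c x (b ⊗ₜ w) = 0 from
    fun x hx => TensorProduct.ext' fun b w => this b w n x hx
  intro b
  induction b using NicholsAlgebra.basis_induction F.dualBasis with
  | one =>
    intro w n x hx
    rw [inducedTensor_one_tmul, mk_eq_zero hx, map_zero, LinearMap.zero_apply,
      TensorProduct.tmul_zero]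
  | add s t hs ht =>
    intro w n x hx
    rw [TensorProduct.add_tmul, map_add, hs w n x hx, ht w n x hx, add_zero]
  | smul r t ht =>
    intro w n x hx
    rw [← TensorProduct.smul_tmul', map_smul, ht w n x hx, smul_zero]
  | mul i b hb =>
    intro w n x hx
    cases n with
    | zero =>
      rw [nicholsKer_zero, Submodule.mem_bot] at hx
      rw [hx, map_zero, LinearMap.zero_apply]
    | succ n =>
      -- The commutation formula rescales its argument, so it is applied to the inversely rescaled
      -- relation to make `x` itself act on `F̄ᵢ b`.
      have h1 : tensorScale F (q i) (tensorScale F (q i)⁻¹ x) = x := by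
        have : (tensorScale F (q i)).comp (tensorScale F (q i)⁻¹) = AlgHom.id k _ :=
          TensorAlgebra.hom_ext (F.ext fun m => by
            simp [tensorScale_ι, smul_smul, inv_mul_cancel₀ (h.ne_zero i m)])
        exact DFunLike.congr_fun this x
      have hx' := h.isAdapted.tensorScale_mem (q i)⁻¹ hx
      have h2 := congrArg (fun f => f (b ⊗ₜ w))
        (inducedBar_mul_tensor h a c hac i (tensorScale F (q i)⁻¹ x))
      simp only [h1, LinearMap.sub_apply, LinearMap.add_apply, Module.End.mul_apply] at h2
      rw [hb w _ _ hx', hb w _ _ (h.isAdapted.leftDeriv_mem i hx'),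
        hb w _ _ (h.isAdapted_inv.leftDeriv_mem i hx'), map_zero, map_zero, add_zero, sub_zero,
        inducedBar_tmul] at h2
      exact h2.symm

/-- The induced module `𝔅(X*) ⊗ W` of the double bosonization. -/
def induced : DoubleBosonization D F g χ q →ₐ[k]
    Module.End k (NicholsAlgebra (dualBraiding D.braiding) ⊗[k] W) :=
  liftGen D F g χ q (inducedGen h a c) (fun i => inducedBar _ W (ι _ (F.dualBasis i)))
    (inducedGrp h c) (inducedTensor_nicholsKer h a c hac)
    (fun n x hx => by
      have : TensorAlgebra.lift k (F.dualBasis.constr k fun i =>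
          inducedBar (dualBraiding D.braiding) W (ι _ (F.dualBasis i))) =
            (inducedBar (dualBraiding D.braiding) W).comp (NicholsAlgebra.mk _) :=
        TensorAlgebra.hom_ext (F.dualBasis.ext fun m => by
          simp [mk_ι, -Module.Basis.coe_dualBasis])
      rw [this, AlgHom.comp_apply, mk_eq_zero hx, map_zero])
    (inducedGrp_mul_gen h a c hac) (inducedGrp_mul_bar h c) (inducedBar_mul_gen h a c)

theorem induced_ofNichols (b : NicholsAlgebra D.braiding) (w : W) :
    induced h a c hac (ofNichols D F g χ q b) (1 ⊗ₜ w) = 1 ⊗ₜ a b w := by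
  obtain ⟨t, rfl⟩ := mk_surjective b
  rw [← inducedTensor_one_tmul h a c]
  have : ((induced h a c hac).comp (ofNichols D F g χ q)).comp (NicholsAlgebra.mk _) = inducedTensor h a c :=
    TensorAlgebra.hom_ext (F.ext fun j => by
      simp only [LinearMap.comp_apply, AlgHom.toLinearMap_apply, AlgHom.comp_apply, mk_ι,
        ofNichols_ι, inducedTensor_ι]
      exact liftGen_gen ..)
  rw [← this]
  rfl

theorem induced_ofNicholsDual (b' b : NicholsAlgebra (dualBraiding D.braiding)) (w : W) :
    induced h a c hac (ofNicholsDual D F g χ q b') (b ⊗ₜ w) = (b' * b) ⊗ₜ w := by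
  have : (induced h a c hac).comp (ofNicholsDual D F g χ q) = inducedBar _ W :=
    NicholsAlgebra.hom_ext F.dualBasis fun j => by
      rw [AlgHom.comp_apply, ofNicholsDual_ι]
      exact liftGen_genBar ..
  rw [← inducedBar_tmul, ← this]
  rfl

theorem induced_grp (γ : Γ) (w : W) :
    induced h a c hac (grp D F g χ q γ) (1 ⊗ₜ w) = 1 ⊗ₜ c γ w := by
  have : induced h a c hac (grp D F g χ q γ) = inducedGrp h c γ := liftGen_grp ..
  rw [this, inducedGrp_tmul, map_one]

end Induced

/-! ### Triangular decomposition -/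

section TriangularDecomposition

open NicholsAlgebra

variable (h : IsSymmetricDiagonal D F g χ q)

/-- The action of `𝔅(X)` on `𝔅(X) ⊗ kΓ`. -/
def bosonNichols (D : YetterDrinfeld k Γ X) : NicholsAlgebra D.braiding →ₐ[k]
    Module.End k (NicholsAlgebra D.braiding ⊗[k] MonoidAlgebra k Γ) :=
  (Module.End.rTensorAlgHom k _ _).comp (Algebra.lmul k _)

theorem bosonNichols_tmul (b b' : NicholsAlgebra D.braiding) (s : MonoidAlgebra k Γ) :
    bosonNichols D b (b' ⊗ₜ s) = (b * b') ⊗ₜ s := rfl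

/-- The action of `Γ` on `𝔅(X) ⊗ kΓ`. -/
def bosonGrp : Γ →* Module.End k (NicholsAlgebra D.braiding ⊗[k] MonoidAlgebra k Γ) where
  toFun γ := TensorProduct.map (scale h.exists_isAdapted fun j => (χ j γ : k)).toLinearMap
    (LinearMap.mulLeft k (MonoidAlgebra.of k Γ γ))
  map_one' := TensorProduct.ext' fun b s => by
    have : (fun j => ((χ j 1 : kˣ) : k)) = 1 := by ext; simp
    rw [TensorProduct.map_tmul, AlgHom.toLinearMap_apply, this, scale_one, map_one,
      LinearMap.mulLeft_one]
    rfl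
  map_mul' γ δ := TensorProduct.ext' fun b s => by
    have : (fun j => ((χ j (γ * δ) : kˣ) : k)) =
        (fun j => (χ j γ : k)) * fun j => (χ j δ : k) := by ext; simp
    simp only [this, TensorProduct.map_tmul, Module.End.mul_apply, LinearMap.mulLeft_apply,
      AlgHom.toLinearMap_apply, scale_scale, map_mul (MonoidAlgebra.of k Γ), mul_assoc]

theorem bosonGrp_tmul (γ : Γ) (b : NicholsAlgebra D.braiding) (s : MonoidAlgebra k Γ) :
    bosonGrp h γ (b ⊗ₜ s) = scale h.exists_isAdapted (fun j => (χ j γ : k)) b ⊗ₜ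
      (MonoidAlgebra.of k Γ γ * s) := rfl

theorem bosonGrp_mul_nichols (γ : Γ) (j : Fin θ) :
    bosonGrp h γ * bosonNichols D (ι D.braiding (F j)) =
      (χ j γ : k) • (bosonNichols D (ι D.braiding (F j)) * bosonGrp h γ) :=
  TensorProduct.ext' fun b s => by
    rw [Module.End.mul_apply, bosonNichols_tmul, bosonGrp_tmul, map_mul, scale_ι,
      LinearMap.smul_apply, Module.End.mul_apply, bosonGrp_tmul, bosonNichols_tmul,
      smul_mul_assoc, TensorProduct.smul_tmul']

/-- The inverse of the multiplication map `𝔅(X*) ⊗ 𝔅(X) ⊗ kΓ → 𝔘`. -/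
def unmul : DoubleBosonization D F g χ q →ₗ[k]
    NicholsAlgebra (dualBraiding D.braiding) ⊗[k]
      (NicholsAlgebra D.braiding ⊗[k] MonoidAlgebra k Γ) :=
  LinearMap.applyₗ (1 ⊗ₜ (1 ⊗ₜ 1)) ∘ₗ
    (induced h (bosonNichols D) (bosonGrp h) (bosonGrp_mul_nichols h)).toLinearMap

/-- Acting on `1 ⊗ (1 ⊗ 1)`, the factors `γ`, `b` and `b'` fill the three slots from right to left;
each meets only `1` to its left, so no correction arises. -/
theorem unmul_mulMap (y : (NicholsAlgebra (dualBraiding D.braiding) ⊗[k]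
    NicholsAlgebra D.braiding) ⊗[k] MonoidAlgebra k Γ) :
    unmul h (mulMap D F g χ q y) = TensorProduct.assoc k _ _ _ y := by
  induction y using TensorProduct.induction_on with
  | zero => simp
  | add x y hx hy => rw [map_add, map_add, map_add, hx, hy]
  | tmul y s =>
    induction y using TensorProduct.induction_on with
    | zero => simp
    | add x y hx hy => rw [TensorProduct.add_tmul, map_add, map_add, map_add, hx, hy]
    | tmul b' b =>
      induction s using MonoidAlgebra.induction_on with
      | of γ =>
        rw [mulMap_tmul, MonoidAlgebra.lift_of, unmul, LinearMap.comp_apply,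
          AlgHom.toLinearMap_apply, LinearMap.applyₗ_apply_apply, map_mul, map_mul,
          Module.End.mul_apply, Module.End.mul_apply, induced_grp, bosonGrp_tmul, map_one,
          mul_one, induced_ofNichols, bosonNichols_tmul, mul_one, induced_ofNicholsDual, mul_one,
          TensorProduct.assoc_tmul]
      | add s t hs ht => rw [TensorProduct.tmul_add, map_add, map_add, map_add, hs, ht]
      | smul r s hs => rw [TensorProduct.tmul_smul, map_smul, map_smul, map_smul, hs]

include h

theorem mulMap_bijective : Function.Bijective (mulMap D F g χ q) := by
  refine ⟨fun x y hxy => ?_, mulMap_surjective h⟩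
  have := congrArg (unmul h) hxy
  rwa [unmul_mulMap, unmul_mulMap, EmbeddingLike.apply_eq_iff_eq] at this

/-- The left inverse reads off the middle tensor factor by applying counits to the outer two. -/
theorem ofNichols_injective : Function.Injective (ofNichols D F g χ q) := by
  refine Function.HasLeftInverse.injective ⟨fun u => TensorProduct.rid k _
    ((Coalgebra.counit (R := k) (A := MonoidAlgebra k Γ)).lTensor _ (TensorProduct.lid k _
      ((counit F.dualBasis).toLinearMap.rTensor _ (unmul h u)))), fun b => ?_⟩
  have := unmul_mulMap h ((1 ⊗ₜ b) ⊗ₜ 1)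
  rw [mulMap_tmul, map_one, map_one, one_mul, mul_one] at this
  simp [this, MonoidAlgebra.one_def]

theorem ofNicholsDual_injective : Function.Injective (ofNicholsDual D F g χ q) := by
  refine Function.HasLeftInverse.injective ⟨fun u => TensorProduct.rid k _
    (((TensorProduct.rid k k).toLinearMap ∘ₗ TensorProduct.map (counit F).toLinearMap
      (Coalgebra.counit (R := k) (A := MonoidAlgebra k Γ))).lTensor _ (unmul h u)), fun b => ?_⟩
  have := unmul_mulMap h ((b ⊗ₜ 1) ⊗ₜ 1)
  rw [mulMap_tmul, map_one, map_one, mul_one, mul_one] at this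
  simp [this, MonoidAlgebra.one_def]

end TriangularDecomposition

end DoubleBosonization

end

noncomputable section

/-! ## The Hopf algebra structure -/

/-- The mixed terms cancel because `x` and `y` commute with `f` and `b` by inverse scalars. For `i =
j` the right side is `gⱼ² ⊗ (1 - gⱼ²) + (1 - gⱼ²) ⊗ 1 = 1 ⊗ 1 - gⱼ² ⊗ gⱼ²`, as the cross relation
requires. -/
theorem comul_cross {k A : Type*} [Field k] [Ring A] [Algebra k A] {x y f b : A} {r : k}
    (hr : r ≠ 0) (hxf : x * f = r • (f * x)) (hyb : y * b = r⁻¹ • (b * y)) (hxy : y * x = x * y) :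
    (x ⊗ₜ[k] b + b ⊗ₜ[k] 1) * (y ⊗ₜ[k] f + f ⊗ₜ[k] 1) -
        r • ((y ⊗ₜ[k] f + f ⊗ₜ[k] 1) * (x ⊗ₜ[k] b + b ⊗ₜ[k] 1)) =
      (x * y) ⊗ₜ[k] (b * f - r • (f * b)) + (b * f - r • (f * b)) ⊗ₜ[k] 1 := by
  simp only [mul_add, add_mul, Algebra.TensorProduct.tmul_mul_tmul, mul_one, one_mul, hxf, hyb,
    hxy, TensorProduct.sub_tmul, TensorProduct.tmul_sub, smul_add, ← TensorProduct.smul_tmul',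
    TensorProduct.tmul_smul, smul_smul, mul_inv_cancel₀ hr, one_smul]
  abel

/-! ### Multiplicativity of the antipode axioms -/

section Antipode

variable {k A : Type*} [Field k] [Ring A] [Algebra k A] (S : A →ₐ[k] Aᵐᵒᵖ)

/-- An algebra map to the opposite algebra, as a linear endomorphism. -/
def unopLinear : A →ₗ[k] A := (MulOpposite.opLinearEquiv k).symm.toLinearMap ∘ₗ S.toLinearMap

theorem unopLinear_apply (a : A) : unopLinear S a = MulOpposite.unop (S a) := rfl

/-- As `S` reverses products, the contraction of `z` ends up between `S(u)` and `v`, and a scalar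
there can be pulled out. Thus the antipode axiom passes to products and need only be checked on
generators. -/
theorem mul'_rTensor_unopLinear_mul {z : A ⊗[k] A} {c : k}
    (hz : LinearMap.mul' k A ((unopLinear S).rTensor A z) = algebraMap k A c) (w : A ⊗[k] A) :
    LinearMap.mul' k A ((unopLinear S).rTensor A (z * w)) =
      c • LinearMap.mul' k A ((unopLinear S).rTensor A w) := by
  induction w using TensorProduct.induction_on with
  | zero => simp
  | add x y hx hy => simp only [mul_add, map_add, hx, hy, smul_add]
  | tmul u v =>
    have key (z) : LinearMap.mul' k A ((unopLinear S).rTensor A (z * (u ⊗ₜ v))) =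
        unopLinear S u * LinearMap.mul' k A ((unopLinear S).rTensor A z) * v := by
      clear hz
      induction z using TensorProduct.induction_on with
      | zero => simp
      | add x y hx hy => simp only [add_mul, mul_add, map_add, hx, hy]
      | tmul x y => simp [unopLinear_apply, mul_assoc]
    rw [key, hz, ← Algebra.commutes, mul_assoc, ← Algebra.smul_def]
    simp

theorem mul'_lTensor_unopLinear_mul {w : A ⊗[k] A} {c : k}
    (hw : LinearMap.mul' k A ((unopLinear S).lTensor A w) = algebraMap k A c) (z : A ⊗[k] A) :
    LinearMap.mul' k A ((unopLinear S).lTensor A (z * w)) =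
      c • LinearMap.mul' k A ((unopLinear S).lTensor A z) := by
  induction z using TensorProduct.induction_on with
  | zero => simp
  | add x y hx hy => simp only [add_mul, map_add, hx, hy, smul_add]
  | tmul u v =>
    have key (w) : LinearMap.mul' k A ((unopLinear S).lTensor A ((u ⊗ₜ v) * w)) =
        u * LinearMap.mul' k A ((unopLinear S).lTensor A w) * unopLinear S v := by
      clear hw
      induction w using TensorProduct.induction_on with
      | zero => simp
      | add x y hx hy => simp only [add_mul, mul_add, map_add, hx, hy]
      | tmul x y => simp [unopLinear_apply, mul_assoc]
    rw [key, hw, ← Algebra.commutes, mul_assoc, ← Algebra.smul_def]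
    simp

end Antipode

theorem NicholsAlgebra.lift_zero_nicholsKer {k V I : Type*} [Field k] [AddCommGroup V] [Module k V]
    {Ψ : V ⊗[k] V →ₗ[k] V ⊗[k] V} (e : Module.Basis I k V) {n : ℕ} {x : TensorAlgebra k V}
    (hx : x ∈ nicholsKer Ψ n) :
    TensorAlgebra.lift k (e.constr k (0 : I → k)) x = 0 := by
  refine map_nicholsKer_eq_zero (f := (TensorAlgebra.lift k (e.constr k (0 : I → k))).toLinearMap) e
    (fun j t => ?_) hx
  rw [AlgHom.toLinearMap_apply, map_mul, TensorAlgebra.lift_ι_apply, Module.Basis.constr_basis,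
    Pi.zero_apply, zero_mul]

namespace DoubleBosonization

set_option linter.unusedSectionVars false

variable {k Γ X : Type*} [Field k] [CommGroup Γ] [AddCommGroup X] [Module k X]
  [FiniteDimensional k X] {θ : ℕ} {D : YetterDrinfeld k Γ X} {F : Module.Basis (Fin θ) k X}
  {g : Fin θ → Γ} {χ : Fin θ → Γ →* kˣ} {q : Fin θ → Fin θ → k}

theorem grp_mul_comm (γ δ : Γ) :
    grp D F g χ q γ * grp D F g χ q δ = grp D F g χ q δ * grp D F g χ q γ := by
  rw [← map_mul, mul_comm, map_mul]

theorem gen_mul_grp_inv (γ : Γ) (j : Fin θ) : gen D F g χ q j * grp D F g χ q γ⁻¹ =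
    (χ j γ : k) • (grp D F g χ q γ⁻¹ * gen D F g χ q j) := by
  rw [grp_mul_gen, smul_smul]
  simp

theorem genBar_mul_grp_inv (γ : Γ) (j : Fin θ) : genBar D F g χ q j * grp D F g χ q γ⁻¹ =
    (χ j γ : k)⁻¹ • (grp D F g χ q γ⁻¹ * genBar D F g χ q j) := by
  rw [grp_mul_genBar, smul_smul]
  simp

/-! ### Coproduct, counit and antipode of `𝔘` -/

variable (h : IsSymmetricDiagonal D F g χ q)

/-- The coproduct of the double bosonization. -/
def comulHom : DoubleBosonization D F g χ q →ₐ[k]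
    DoubleBosonization D F g χ q ⊗[k] DoubleBosonization D F g χ q :=
  liftGen D F g χ q
    (fun j => grp D F g χ q (g j) ⊗ₜ gen D F g χ q j + gen D F g χ q j ⊗ₜ 1)
    (fun j => grp D F g χ q (g j) ⊗ₜ genBar D F g χ q j + genBar D F g χ q j ⊗ₜ 1)
    { toFun := fun γ => grp D F g χ q γ ⊗ₜ grp D F g χ q γ
      map_one' := by rw [map_one]; rfl
      map_mul' := fun γ δ => by rw [map_mul, Algebra.TensorProduct.tmul_mul_tmul] }
    (NicholsAlgebra.coproduct_nicholsKer h.isAdapted (α := ofNichols D F g χ q)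
      (G := fun j => grp D F g χ q (g j)) (fun _ _ => grp_mul_comm _ _)
      (fun i j => by rw [ofNichols_ι, grp_mul_gen, h.eq_char])
      _ (fun j => by
        rw [ofNichols_ι, TensorAlgebra.lift_ι_apply, Module.Basis.constr_basis]))
    -- `gᵢ` commutes with `F̄ⱼ` by `q_{ij}⁻¹`, although the braiding of `X*` has matrix `q`: the
    -- `q⁻¹` description of the relations is the one that fits.
    (NicholsAlgebra.coproduct_nicholsKer h.isAdapted_dual_inv (α := ofNicholsDual D F g χ q)
      (G := fun j => grp D F g χ q (g j)) (fun _ _ => grp_mul_comm _ _)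
      (fun i j => by rw [ofNicholsDual_ι, grp_mul_genBar, Pi.inv_apply, Pi.inv_apply, h.eq_char])
      _ (fun j => by
        rw [ofNicholsDual_ι, TensorAlgebra.lift_ι_apply, Module.Basis.constr_basis]))
    (fun γ j => by
      simp only [MonoidHom.coe_mk, OneHom.coe_mk, mul_add, add_mul,
        Algebra.TensorProduct.tmul_mul_tmul, mul_one, one_mul, grp_mul_gen, smul_add,
        TensorProduct.tmul_smul, ← TensorProduct.smul_tmul', grp_mul_comm γ])
    (fun γ j => by
      simp only [MonoidHom.coe_mk, OneHom.coe_mk, mul_add, add_mul,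
        Algebra.TensorProduct.tmul_mul_tmul, mul_one, one_mul, grp_mul_genBar, smul_add,
        TensorProduct.tmul_smul, ← TensorProduct.smul_tmul', grp_mul_comm γ])
    (fun i j => by
      rw [comul_cross (h.ne_zero j i) (by rw [grp_mul_gen, ← h.eq_char, h.symm])
        (by rw [grp_mul_genBar, ← h.eq_char]) (grp_mul_comm _ _), genBar_mul_gen]
      by_cases hij : i = j
      · subst hij
        simp only [if_true, MonoidHom.coe_mk, OneHom.coe_mk, pow_two,
          Algebra.TensorProduct.tmul_mul_tmul, TensorProduct.tmul_sub, TensorProduct.sub_tmul,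
          Algebra.TensorProduct.one_def]
        abel
      · simp [hij])

theorem comulHom_gen (j : Fin θ) : comulHom h (gen D F g χ q j) =
    grp D F g χ q (g j) ⊗ₜ gen D F g χ q j + gen D F g χ q j ⊗ₜ 1 := liftGen_gen ..

theorem comulHom_genBar (j : Fin θ) : comulHom h (genBar D F g χ q j) =
    grp D F g χ q (g j) ⊗ₜ genBar D F g χ q j + genBar D F g χ q j ⊗ₜ 1 := liftGen_genBar ..

theorem comulHom_grp (γ : Γ) : comulHom h (grp D F g χ q γ) =
    grp D F g χ q γ ⊗ₜ grp D F g χ q γ := liftGen_grp ..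

variable (D F g χ q) in
/-- The counit of the double bosonization. -/
def counitHom : DoubleBosonization D F g χ q →ₐ[k] k :=
  liftGen D F g χ q 0 0 1
    (fun _ _ hx => NicholsAlgebra.lift_zero_nicholsKer F hx)
    (fun _ _ hx => NicholsAlgebra.lift_zero_nicholsKer F.dualBasis hx)
    (by simp) (by simp) (by simp)

theorem counitHom_gen (j : Fin θ) : counitHom D F g χ q (gen D F g χ q j) = 0 := liftGen_gen ..

theorem counitHom_genBar (j : Fin θ) : counitHom D F g χ q (genBar D F g χ q j) = 0 :=
  liftGen_genBar ..

theorem counitHom_grp (γ : Γ) : counitHom D F g χ q (grp D F g χ q γ) = 1 := liftGen_grp ..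

/-- The antipode of the double bosonization, as an algebra map to the opposite algebra. -/
def antipodeHom : DoubleBosonization D F g χ q →ₐ[k] (DoubleBosonization D F g χ q)ᵐᵒᵖ :=
  liftGen D F g χ q
    (fun j => MulOpposite.op (-(grp D F g χ q (g j)⁻¹ * gen D F g χ q j)))
    (fun j => MulOpposite.op (-(grp D F g χ q (g j)⁻¹ * genBar D F g χ q j)))
    { toFun := fun γ => MulOpposite.op (grp D F g χ q γ⁻¹)
      map_one' := by simp
      map_mul' := fun γ δ => by rw [mul_inv_rev, map_mul, MulOpposite.op_mul] }
    (NicholsAlgebra.antipode_nicholsKer h.isAdapted h.isAdapted_inv h.symm h.ne_zero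
      (α := ofNichols D F g χ q) (G := fun j => grp D F g χ q (g j)⁻¹)
      (fun _ _ => grp_mul_comm _ _)
      (fun i j => by rw [ofNichols_ι, gen_mul_grp_inv, h.eq_char])
      _ (fun j => by
        rw [ofNichols_ι, TensorAlgebra.lift_ι_apply, Module.Basis.constr_basis]))
    (NicholsAlgebra.antipode_nicholsKer h.isAdapted_dual_inv
      (by rw [inv_inv]; exact h.isAdapted_dual)
      (fun i j => congrArg _ (h.symm i j)) (fun i j => inv_ne_zero (h.ne_zero i j))
      (α := ofNicholsDual D F g χ q) (G := fun j => grp D F g χ q (g j)⁻¹)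
      (fun _ _ => grp_mul_comm _ _)
      (fun i j => by
        rw [ofNicholsDual_ι, genBar_mul_grp_inv, Pi.inv_apply, Pi.inv_apply, h.eq_char])
      _ (fun j => by
        rw [ofNicholsDual_ι, TensorAlgebra.lift_ι_apply, Module.Basis.constr_basis]))
    (fun γ j => by
      simp only [MonoidHom.coe_mk, OneHom.coe_mk, ← MulOpposite.op_mul, ← MulOpposite.op_smul]
      congr 1
      rw [neg_mul, mul_neg, smul_neg, mul_assoc, gen_mul_grp_inv, mul_smul_comm, ← mul_assoc,
        ← mul_assoc, grp_mul_comm γ⁻¹])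
    (fun γ j => by
      simp only [MonoidHom.coe_mk, OneHom.coe_mk, ← MulOpposite.op_mul, ← MulOpposite.op_smul]
      congr 1
      rw [neg_mul, mul_neg, smul_neg, mul_assoc, genBar_mul_grp_inv, mul_smul_comm, ← mul_assoc,
        ← mul_assoc, grp_mul_comm γ⁻¹])
    (fun i j => by
      -- In the opposite algebra the left side becomes `-gᵢ⁻¹ gⱼ⁻¹` times the original cross
      -- relation; for `i = j` this gives `-gⱼ⁻² (1 - gⱼ²) = 1 - gⱼ⁻²`.
      have h1 : grp D F g χ q (g j)⁻¹ * gen D F g χ q j *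
          (grp D F g χ q (g i)⁻¹ * genBar D F g χ q i) =
          q j i • (grp D F g χ q (g i)⁻¹ * grp D F g χ q (g j)⁻¹ *
            (gen D F g χ q j * genBar D F g χ q i)) := by
        rw [mul_assoc, ← mul_assoc (gen D F g χ q j), gen_mul_grp_inv, ← h.eq_char, h.symm i j,
          smul_mul_assoc, mul_smul_comm, grp_mul_comm (g i)⁻¹]
        simp only [mul_assoc]
      have h2 : grp D F g χ q (g i)⁻¹ * genBar D F g χ q i *
          (grp D F g χ q (g j)⁻¹ * gen D F g χ q j) =
          (q j i)⁻¹ • (grp D F g χ q (g i)⁻¹ * grp D F g χ q (g j)⁻¹ *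
            (genBar D F g χ q i * gen D F g χ q j)) := by
        rw [mul_assoc, ← mul_assoc (genBar D F g χ q i), genBar_mul_grp_inv, ← h.eq_char,
          smul_mul_assoc, mul_smul_comm]
        simp only [mul_assoc]
      have h3 := genBar_mul_gen D F g χ q i j
      simp only [MonoidHom.coe_mk, OneHom.coe_mk, ← MulOpposite.op_mul, ← MulOpposite.op_smul,
        ← MulOpposite.op_sub, neg_mul_neg, h1, h2, smul_smul, mul_inv_cancel₀ (h.ne_zero j i),
        one_smul]
      rw [sub_eq_iff_eq_add] at h3
      rw [h3, mul_add, mul_smul_comm, sub_add_cancel_right]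
      by_cases hij : i = j
      · subst hij
        simp only [if_true, ← MulOpposite.op_one, ← MulOpposite.op_pow, ← MulOpposite.op_sub]
        congr 1
        rw [mul_sub, mul_one, ← map_pow, ← map_mul, ← map_mul, ← map_pow, neg_sub, ← pow_two,
          inv_pow, inv_mul_cancel, map_one]
      · simp [hij])

/-- The antipode of the double bosonization. -/
def antipodeMap : DoubleBosonization D F g χ q →ₗ[k] DoubleBosonization D F g χ q :=
  unopLinear (antipodeHom h)

theorem antipodeMap_gen (j : Fin θ) : antipodeMap h (gen D F g χ q j) =
    -(grp D F g χ q (g j)⁻¹ * gen D F g χ q j) :=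
  congrArg MulOpposite.unop (liftGen_gen ..)

theorem antipodeMap_genBar (j : Fin θ) : antipodeMap h (genBar D F g χ q j) =
    -(grp D F g χ q (g j)⁻¹ * genBar D F g χ q j) :=
  congrArg MulOpposite.unop (liftGen_genBar ..)

theorem antipodeMap_grp (γ : Γ) : antipodeMap h (grp D F g χ q γ) = grp D F g χ q γ⁻¹ :=
  congrArg MulOpposite.unop (liftGen_grp ..)

theorem antipodeMap_one : antipodeMap h 1 = 1 := by
  rw [antipodeMap, unopLinear_apply, map_one, MulOpposite.unop_one]

theorem mul_antipode_rTensor (u : DoubleBosonization D F g χ q) :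
    LinearMap.mul' k _ ((antipodeMap h).rTensor _ (comulHom h u)) =
      algebraMap k _ (counitHom D F g χ q u) := by
  induction u using gen_induction with
  | algebraMap c =>
    rw [AlgHom.commutes, AlgHom.commutes, Algebra.TensorProduct.algebraMap_apply]
    simp [Algebra.algebraMap_eq_smul_one, antipodeMap_one]
  | gen j =>
    rw [comulHom_gen, counitHom_gen]
    simp [antipodeMap_gen, antipodeMap_grp]
  | genBar j =>
    rw [comulHom_genBar, counitHom_genBar]
    simp [antipodeMap_genBar, antipodeMap_grp]
  | grp γ =>
    rw [comulHom_grp, counitHom_grp, LinearMap.rTensor_tmul, LinearMap.mul'_apply,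
      antipodeMap_grp, ← map_mul, inv_mul_cancel, map_one, map_one]
  | add u v hu hv => simp only [map_add, hu, hv]
  | mul u v hu hv =>
    rw [map_mul (comulHom h), map_mul (counitHom D F g χ q), map_mul (algebraMap k _), ← hv, ← Algebra.smul_def]
    exact mul'_rTensor_unopLinear_mul _ hu _

theorem mul_antipode_lTensor (u : DoubleBosonization D F g χ q) :
    LinearMap.mul' k _ ((antipodeMap h).lTensor _ (comulHom h u)) =
      algebraMap k _ (counitHom D F g χ q u) := by
  induction u using gen_induction with
  | algebraMap c =>
    rw [AlgHom.commutes, AlgHom.commutes, Algebra.TensorProduct.algebraMap_apply]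
    simp [Algebra.algebraMap_eq_smul_one, antipodeMap_one]
  | gen j =>
    rw [comulHom_gen, counitHom_gen, map_add, LinearMap.lTensor_tmul, LinearMap.lTensor_tmul,
      map_add, LinearMap.mul'_apply, LinearMap.mul'_apply, antipodeMap_gen, antipodeMap_one,
      mul_neg, ← mul_assoc, grp_mul_grp_inv, one_mul, mul_one, neg_add_cancel, map_zero]
  | genBar j =>
    rw [comulHom_genBar, counitHom_genBar, map_add, LinearMap.lTensor_tmul, LinearMap.lTensor_tmul,
      map_add, LinearMap.mul'_apply, LinearMap.mul'_apply, antipodeMap_genBar, antipodeMap_one,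
      mul_neg, ← mul_assoc, grp_mul_grp_inv, one_mul, mul_one, neg_add_cancel, map_zero]
  | grp γ =>
    rw [comulHom_grp, counitHom_grp, LinearMap.lTensor_tmul, LinearMap.mul'_apply,
      antipodeMap_grp, grp_mul_grp_inv, map_one]
  | add u v hu hv => simp only [map_add, hu, hv]
  | mul u v hu hv =>
    rw [map_mul (comulHom h), map_mul (counitHom D F g χ q), mul_comm (counitHom D F g χ q u),
      map_mul (algebraMap k _), ← hu, ← Algebra.smul_def]
    exact mul'_lTensor_unopLinear_mul _ hv _

/-- The bialgebra structure of the double bosonization. -/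
abbrev bialgebra : Bialgebra k (DoubleBosonization D F g χ q) :=
  Bialgebra.ofAlgHom (comulHom h) (counitHom D F g χ q)
    (hom_ext
      (fun j => by
        simp [comulHom_gen, comulHom_grp, TensorProduct.tmul_add, TensorProduct.add_tmul,
          Algebra.TensorProduct.one_def, add_assoc])
      (fun j => by
        simp [comulHom_genBar, comulHom_grp, TensorProduct.tmul_add, TensorProduct.add_tmul,
          Algebra.TensorProduct.one_def, add_assoc])
      (fun γ => by simp [comulHom_grp]))
    (hom_ext
      (fun j => by simp [comulHom_gen, counitHom_gen, counitHom_grp])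
      (fun j => by simp [comulHom_genBar, counitHom_genBar, counitHom_grp])
      (fun γ => by simp [comulHom_grp, counitHom_grp]))
    (hom_ext
      (fun j => by simp [comulHom_gen, counitHom_gen])
      (fun j => by simp [comulHom_genBar, counitHom_genBar])
      (fun γ => by simp [comulHom_grp, counitHom_grp]))

/-- The Hopf algebra structure of the double bosonization. -/
abbrev hopfAlgebra : HopfAlgebra k (DoubleBosonization D F g χ q) where
  __ := bialgebra h
  antipode := antipodeMap h
  mul_antipode_rTensor_comul := LinearMap.ext (mul_antipode_rTensor h)
  mul_antipode_lTensor_comul := LinearMap.ext (mul_antipode_lTensor h)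

theorem hasRadfordHopfStructure :
    @HasRadfordHopfStructure k (DoubleBosonization D F g χ q) _ _ (hopfAlgebra h) Γ _ θ
      (grp D F g χ q) g (gen D F g χ q) (genBar D F g χ q) :=
  letI := hopfAlgebra h
  { comul_G := comulHom_grp h
    comul_F := comulHom_gen h
    comul_Fbar := comulHom_genBar h
    counit_G := counitHom_grp
    counit_F := counitHom_gen
    counit_Fbar := counitHom_genBar
    antipode_G := antipodeMap_grp h
    antipode_F := antipodeMap_gen h
    antipode_Fbar := antipodeMap_genBar h }

/-! ## The universal property when the `g i` generate `Γ` -/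

/-- The `γ` that commute with `y` up to `ψ γ` are closed under products and inverses. -/
theorem mul_eq_smul_of_closure_eq_top (hg : Subgroup.closure (Set.range g) = ⊤) {A : Type*} [Ring A]
    [Algebra k A] {c : Γ →* A} {ψ : Γ →* kˣ} {y : A}
    (hy : ∀ i, c (g i) * y * c (g i)⁻¹ = (ψ (g i) : k) • y) (γ : Γ) :
    c γ * y = (ψ γ : k) • (y * c γ) := by
  have hc (γ : Γ) : c γ⁻¹ * c γ = 1 := by rw [← map_mul, inv_mul_cancel, map_one]
  have hc' (γ : Γ) : c γ * c γ⁻¹ = 1 := by rw [← map_mul, mul_inv_cancel, map_one]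
  have hγ : γ ∈ Subgroup.closure (Set.range g) := by rw [hg]; trivial
  induction hγ using Subgroup.closure_induction with
  | mem _ hx =>
    obtain ⟨i, rfl⟩ := hx
    rw [← smul_mul_assoc, ← hy, mul_assoc, hc, mul_one]
  | one => simp
  | mul γ δ _ _ hγ hδ =>
    rw [map_mul, mul_assoc, hδ, mul_smul_comm, ← mul_assoc, hγ, smul_mul_assoc, smul_smul,
      mul_assoc, map_mul, Units.val_mul, mul_comm (ψ γ : k)]
  | inv γ _ hγ =>
    have h1 : y * c γ⁻¹ = (ψ γ : k) • (c γ⁻¹ * y) := by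
      calc y * c γ⁻¹ = c γ⁻¹ * (c γ * y) * c γ⁻¹ := by rw [← mul_assoc, hc, one_mul]
        _ = _ := by
          rw [hγ, mul_smul_comm, smul_mul_assoc, mul_assoc, mul_assoc, hc', mul_one]
    rw [h1, smul_smul, map_inv ψ, ← Units.val_mul, inv_mul_cancel, Units.val_one, one_smul]

include h in
theorem existsUnique_hom (hg : Subgroup.closure (Set.range g) = ⊤) {A : Type*} [Ring A]
    [Algebra k A] (a : NicholsAlgebra D.braiding →ₐ[k] A)
    (b : NicholsAlgebra (dualBraiding D.braiding) →ₐ[k] A) (c : Γ →* A)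
    (hca : ∀ i j, c (g i) * a (NicholsAlgebra.ι D.braiding (F j)) * c (g i)⁻¹ =
      q i j • a (NicholsAlgebra.ι D.braiding (F j)))
    (hba : ∀ i j, b (NicholsAlgebra.ι (dualBraiding D.braiding) (F.dualBasis i)) *
          a (NicholsAlgebra.ι D.braiding (F j)) -
        q j i • (a (NicholsAlgebra.ι D.braiding (F j)) *
          b (NicholsAlgebra.ι (dualBraiding D.braiding) (F.dualBasis i))) =
      if i = j then 1 - c (g j) ^ 2 else 0)
    (hcb : ∀ i j, c (g i) * b (NicholsAlgebra.ι (dualBraiding D.braiding) (F.dualBasis j)) *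
          c (g i)⁻¹ =
      (q i j)⁻¹ • b (NicholsAlgebra.ι (dualBraiding D.braiding) (F.dualBasis j))) :
    ∃! f : DoubleBosonization D F g χ q →ₐ[k] A,
      f.comp (ofNichols D F g χ q) = a ∧ f.comp (ofNicholsDual D F g χ q) = b ∧
        ∀ γ, f (grp D F g χ q γ) = c γ := by
  have ha (n : ℕ) (x) (hx : x ∈ nicholsKer D.braiding n) : TensorAlgebra.lift k
      (F.constr k fun j => a (NicholsAlgebra.ι D.braiding (F j))) x = 0 := by
    have : TensorAlgebra.lift k (F.constr k fun j => a (NicholsAlgebra.ι D.braiding (F j))) =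
        a.comp (NicholsAlgebra.mk _) :=
      TensorAlgebra.hom_ext (F.ext fun m => by simp [NicholsAlgebra.mk_ι])
    rw [this, AlgHom.comp_apply, NicholsAlgebra.mk_eq_zero hx, map_zero]
  have hb (n : ℕ) (x) (hx : x ∈ nicholsKer (dualBraiding D.braiding) n) : TensorAlgebra.lift k
      (F.dualBasis.constr k fun j =>
        b (NicholsAlgebra.ι (dualBraiding D.braiding) (F.dualBasis j))) x = 0 := by
    have : TensorAlgebra.lift k (F.dualBasis.constr k fun j =>
        b (NicholsAlgebra.ι (dualBraiding D.braiding) (F.dualBasis j))) =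
          b.comp (NicholsAlgebra.mk _) :=
      TensorAlgebra.hom_ext (F.dualBasis.ext fun m => by
        simp [NicholsAlgebra.mk_ι, -Module.Basis.coe_dualBasis])
    rw [this, AlgHom.comp_apply, NicholsAlgebra.mk_eq_zero hx, map_zero]
  refine ⟨liftGen D F g χ q _ _ c ha hb
    (fun γ j => mul_eq_smul_of_closure_eq_top hg (fun i => by rw [hca, h.eq_char]) γ)
    (fun γ j => (mul_eq_smul_of_closure_eq_top (ψ := (χ j)⁻¹) hg
      (fun i => by rw [hcb, h.eq_char]; simp) γ).trans (by simp)) hba, ⟨?_, ?_, ?_⟩, ?_⟩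
  · exact NicholsAlgebra.hom_ext F fun j => by
      rw [AlgHom.comp_apply, ofNichols_ι, liftGen_gen]
  · exact NicholsAlgebra.hom_ext F.dualBasis fun j => by
      rw [AlgHom.comp_apply, ofNicholsDual_ι, liftGen_genBar]
  · exact fun γ => liftGen_grp ..
  · rintro f ⟨rfl, rfl, hf⟩
    refine hom_ext (fun i => ?_) (fun i => ?_) fun γ => ?_
    · rw [liftGen_gen, AlgHom.comp_apply, ofNichols_ι]
    · rw [liftGen_genBar, AlgHom.comp_apply, ofNicholsDual_ι]
    · rw [liftGen_grp, hf]

end DoubleBosonization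

end

/-! ### The main theorem -/

theorem mainTheorem2 {k : Type*} {Γ : Type*} {X : Type*} [Field k]
    [CommGroup Γ] [AddCommGroup X] [Module k X] [FiniteDimensional k X] {θ : ℕ}
    (D : YetterDrinfeld k Γ X) (F : Module.Basis (Fin θ) k X)
    (g : Fin θ → Γ) (χ : Fin θ → Γ →* kˣ) (q : Fin θ → Fin θ → k)
    (hcoact : ∀ i, D.coact (F i) = MonoidAlgebra.of k Γ (g i) ⊗ₜ[k] F i)
    (hact : ∀ γ i, D.act γ (F i) = (χ i γ : k) • F i)
    (hbraiding : ∀ i j, D.braiding (F i ⊗ₜ[k] F j) = q i j • (F j ⊗ₜ[k] F i))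
    (hsymm : ∀ i j, q i j = q j i) :
    -- the canonical maps from the two Nichols algebras send generators to generators,
    -- and are injective
    (∀ i, DoubleBosonization.ofNichols D F g χ q (NicholsAlgebra.ι D.braiding (F i)) =
        DoubleBosonization.gen D F g χ q i) ∧
    (∀ i, DoubleBosonization.ofNicholsDual D F g χ q
        (NicholsAlgebra.ι (dualBraiding D.braiding) (F.dualBasis i)) =
          DoubleBosonization.genBar D F g χ q i) ∧
    Function.Injective (DoubleBosonization.ofNichols D F g χ q) ∧
    Function.Injective (DoubleBosonization.ofNicholsDual D F g χ q) ∧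
    -- as a vector space, the algebra is `𝔅(X*) ⊗ 𝔅(X) ⊗ kΓ`
    Function.Bijective (DoubleBosonization.mulMap D F g χ q) ∧
    -- the relations
    (∀ i j, DoubleBosonization.grp D F g χ q (g i) * DoubleBosonization.gen D F g χ q j *
        DoubleBosonization.grp D F g χ q (g i)⁻¹ =
          q i j • DoubleBosonization.gen D F g χ q j) ∧
    (∀ i j, DoubleBosonization.genBar D F g χ q i * DoubleBosonization.gen D F g χ q j -
        q j i • (DoubleBosonization.gen D F g χ q j * DoubleBosonization.genBar D F g χ q i) =
          if i = j then 1 - DoubleBosonization.grp D F g χ q (g j) ^ 2 else 0) ∧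
    (∀ i j, DoubleBosonization.grp D F g χ q (g i) * DoubleBosonization.genBar D F g χ q j *
        DoubleBosonization.grp D F g χ q (g i)⁻¹ =
          (q i j)⁻¹ • DoubleBosonization.genBar D F g χ q j) ∧
    -- if the `g i` generate `Γ`, these relations are defining
    (Subgroup.closure (Set.range g) = ⊤ →
      ∀ (A : Type*) [Ring A] [Algebra k A] (a : NicholsAlgebra D.braiding →ₐ[k] A)
        (b : NicholsAlgebra (dualBraiding D.braiding) →ₐ[k] A) (c : Γ →* A),
        (∀ i j, c (g i) * a (NicholsAlgebra.ι D.braiding (F j)) * c (g i)⁻¹ =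
          q i j • a (NicholsAlgebra.ι D.braiding (F j))) →
        (∀ i j, b (NicholsAlgebra.ι (dualBraiding D.braiding) (F.dualBasis i)) *
              a (NicholsAlgebra.ι D.braiding (F j)) -
            q j i • (a (NicholsAlgebra.ι D.braiding (F j)) *
              b (NicholsAlgebra.ι (dualBraiding D.braiding) (F.dualBasis i))) =
          if i = j then 1 - c (g j) ^ 2 else 0) →
        (∀ i j, c (g i) * b (NicholsAlgebra.ι (dualBraiding D.braiding) (F.dualBasis j)) *
              c (g i)⁻¹ =
          (q i j)⁻¹ • b (NicholsAlgebra.ι (dualBraiding D.braiding) (F.dualBasis j))) →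
        ∃! f : DoubleBosonization D F g χ q →ₐ[k] A,
          f.comp (DoubleBosonization.ofNichols D F g χ q) = a ∧
          f.comp (DoubleBosonization.ofNicholsDual D F g χ q) = b ∧
          ∀ γ, f (DoubleBosonization.grp D F g χ q γ) = c γ) ∧
    -- the Hopf algebra structure, on the given algebra
    (∃ H : HopfAlgebra k (DoubleBosonization D F g χ q),
      H.toAlgebra = DoubleBosonization.instAlgebra D F g χ q ∧
      @HasRadfordHopfStructure k (DoubleBosonization D F g χ q) _ _ H Γ _ θ
        (DoubleBosonization.grp D F g χ q) g
        (DoubleBosonization.gen D F g χ q) (DoubleBosonization.genBar D F g χ q)) := by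
  have h : IsSymmetricDiagonal D F g χ q := by
    -- The braiding computed from the coaction and the action is compared with the given one in the
    -- coefficient of `F j ⊗ F i`.
    have hq (i j : Fin θ) : q i j = χ j (g i) := by
      have h1 := (hbraiding i j).symm.trans (YetterDrinfeld.braiding_tmul hcoact hact i j)
      have h2 := congrArg (fun z => (F.tensorProduct F).repr z (j, i)) h1
      simpa using h2
    exact ⟨eq_diagBraiding F hbraiding, hsymm, hq⟩
  refine ⟨DoubleBosonization.ofNichols_ι D F g χ q, DoubleBosonization.ofNicholsDual_ι D F g χ q,
    DoubleBosonization.ofNichols_injective h, DoubleBosonization.ofNicholsDual_injective h,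
    DoubleBosonization.mulMap_bijective h, fun i j => ?_,
    DoubleBosonization.genBar_mul_gen D F g χ q, fun i j => ?_,
    fun hg A _ _ a b c hca hba hcb => DoubleBosonization.existsUnique_hom h hg a b c hca hba hcb,
    DoubleBosonization.hopfAlgebra h, rfl, DoubleBosonization.hasRadfordHopfStructure h⟩
  · rw [DoubleBosonization.grp_mul_gen, smul_mul_assoc, mul_assoc,
      DoubleBosonization.grp_mul_grp_inv, mul_one, h.eq_char]
  · rw [DoubleBosonization.grp_mul_genBar, smul_mul_assoc, mul_assoc,
      DoubleBosonization.grp_mul_grp_inv, mul_one, h.eq_char]
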